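/- **Model.** Infinitely many clients and finitely many servers exchange messages (clients with servers, servers among each other) in an asynchronous system: every message is eventually received, exactly once and unmodified, after an arbitrary finite delay and in any order; every process is a deterministic state machine that takes local steps forever (a client only while it executes a transaction) and has no clock. In arbitrary executions, which the safety properties refer to, messages may also stay in transit; executions with the guarantees just listed are called fair. A storage is a finite non-empty set of objects, initialised to $\bot$; values come from an infinite set, and every value is written at most once. Each object is stored by at least one server, and no server stores all objects (in particular the objects may be partitioned among two or more servers each storing at least one object). A client may request any transaction $T=(R_T,W_T)$, which reads the objects of $R_T$ and writes values to the objects of $W_T$, both sets being arbitrary; it requests one transaction at a time, sends messages only while it executes a transaction, and eventually returns from every transaction in every fair execution. A server sends messages to a client only after having received one from that client. A client does not answer reads from its own memory; servers return one and only one value per object: for every $x\in R_T$, the messages that the client receives from a single server storing $x$ while it executes $T$ reveal (given the client's state when it started $T$) at most one value of $x$, all servers storing $x$ that reveal a value of $x$ reveal the same one, at least one does, and it is the value which the client returns for $x$. **Causal consistency.** For operations $\alpha,\beta$ (reads $r(x)v$, writes $w(x)v$) let $\alpha\rightsquigarrow\beta$ be the least transitive relation with $\alpha\rightsquigarrow\beta$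 if some client executes the transaction of $\alpha$ before that of $\beta$, or if $\alpha=w(x)v$ and $\beta=r(x)v$. The storage is causally consistent if at every point of every execution and for each client $C$, all transactions that contain a write and all transactions of $C$ can be totally ordered so that, for the reads of the ordered transactions, (1) for a read $r(x)v$ with $v\neq\bot$ the last write to $x$ preceding the transaction of the read writes $v$; (2) for a read $r(x)\bot$ no write to $x$ precedes its transaction; (3) if $\alpha\rightsquigarrow\beta$ then the transaction of $\alpha$ precedes that of $\beta$. **Progress.** In every fair execution, for every write $w=w(x)v$ there is a finite time $\tau$ such that every read of $x$ that starts at or after $\tau$ returns $v$, or a value $v'$ such that $w(x)v'$ returns no earlier than $w$ starts. **Fast transactions.** A transaction $T$ is fast if, whenever a client $C$ invokes $T$ and however messages are scheduled, the following holds, provided that the processes keep taking steps, that messages between $C$ and servers are eventually received, and that from the moment a server has received a message of this invocation from $C$ until the invocation ends, this server receives no message from any server and its messages to servers are delayed (messages not involving $C$ may be delayed arbitrarily): the invocation ends, and during it $C$ sends at most one message to each server, receives at most one message sent during the invocation from each server, and sends nothing once it has received such a message. **Theorem.** No implementation of a causally consistent storage in this model which guarantees progress provides fast read-only transactions, i.e.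 there is none in which every transaction with $W_T=\emptyset$ is fast. -/

import Mathlib

namespace CausalStorage

/-- A transaction: a read set, and a partial assignment of values to objects; its write set is the
domain of that assignment.  Either set may be empty. -/
structure Txn (Obj Val : Type*) where
  reads : Finset Obj
  writes : Obj → Option Val

/-- A transaction with an empty write set. -/
def Txn.ReadOnly {Obj Val : Type*} (T : Txn Obj Val) : Prop := ∀ x, T.writes x = none

/-- A message together with its sender and its destination. -/
structure Envelope (Client Server Msg : Type*) where
  src : Client ⊕ Server
  dst : Client ⊕ Server
  body : Msg

/-- What can trigger a step of a client: the request of a transaction, the reception of a message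
from a server, or nothing (a spontaneous local step). -/
inductive ClientInput (Obj Val Server Msg : Type*) where
  | start (T : Txn Obj Val)
  | recv (s : Server) (m : Msg)
  | tick

/-- An implementation of a storage: a deterministic state machine for every client and for every
server.  A step of a server is triggered by the reception of a message or by nothing (`none`), and
yields a new state and a list of messages to be sent.  A step of a client also says whether the
client returns from its current transaction, and with which values for the objects
(`none : Option Val` is the initial value `⊥`; only the values at the read set matter).
Processes have no access to a clock. -/
structure Protocol (Obj Val Client Server Msg SState CState : Type*) where
  serverInit : Server → SState
  clientInit : Client → CState
  serverStep : Server → SState → Option ((Client ⊕ Server) × Msg) →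
    SState × List ((Client ⊕ Server) × Msg)
  clientStep : Client → CState → ClientInput Obj Val Server Msg →
    CState × List (Server × Msg) × Option (Obj → Option Val)

/-- A global configuration.  `sent` lists all messages sent so far, so a message is identified by
its index in `sent`; `received` is the set of (indices of) messages already received. -/
structure Config (Obj Val Client Server Msg SState CState : Type*) where
  serverState : Server → SState
  clientState : Client → CState
  /-- the transaction which a client is currently executing, if any -/
  active : Client → Option (Txn Obj Val)
  sent : List (Envelope Client Server Msg)
  received : Set ℕ

/-- A scheduling decision: a client requests a transaction, the message of index `i` is received,
or a process takes a spontaneous local step. -/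
inductive Action (Obj Val Client Server : Type*) where
  | start (c : Client) (T : Txn Obj Val)
  | deliver (i : ℕ)
  | clientTick (c : Client)
  | serverTick (s : Server)

namespace Protocol

variable {Obj Val Client Server Msg SState CState : Type*}
  (A : Protocol Obj Val Client Server Msg SState CState)

/-- The initial configuration. -/
def initial : Config Obj Val Client Server Msg SState CState where
  serverState := A.serverInit
  clientState := A.clientInit
  active := fun _ => none
  sent := []
  received := ∅

open Classical in
/-- A step of server `s`. -/
noncomputable def serverMove (g : Config Obj Val Client Server Msg SState CState) (s : Server)
    (inp : Option ((Client ⊕ Server) × Msg)) : Config Obj Val Client Server Msg SState CState :=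
  let o := A.serverStep s (g.serverState s) inp
  { g with
    serverState := Function.update g.serverState s o.1
    sent := g.sent ++ o.2.map (fun p => ⟨Sum.inr s, p.1, p.2⟩) }

open Classical in
/-- A step of client `c`.  A client that executes no transaction (and receives a late message) only
updates its state: it sends nothing and returns nothing. -/
noncomputable def clientMove (g : Config Obj Val Client Server Msg SState CState) (c : Client)
    (inp : ClientInput Obj Val Server Msg) : Config Obj Val Client Server Msg SState CState :=
  let o := A.clientStep c (g.clientState c) inp
  if g.active c = none then
    { g with clientState := Function.update g.clientState c o.1 }
  else
    { g with
      clientState := Function.update g.clientState c o.1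
      active := if o.2.2.isSome then Function.update g.active c none else g.active
      sent := g.sent ++ o.2.1.map (fun p => ⟨Sum.inl c, Sum.inr p.1, p.2⟩) }

/-- Which actions are possible in a configuration.  Clients are sequential.  A message which has
been sent can be received at any later point, in any order, but only once. -/
def Enabled (g : Config Obj Val Client Server Msg SState CState) :
    Action Obj Val Client Server → Prop
  | .start c _ => g.active c = none
  | .deliver i => i < g.sent.length ∧ i ∉ g.received
  | .clientTick c => g.active c ≠ none
  | .serverTick _ => True

open Classical in
/-- The configuration after an action. -/
noncomputable def next (g : Config Obj Val Client Server Msg SState CState) :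
    Action Obj Val Client Server → Config Obj Val Client Server Msg SState CState
  | .start c T =>
      A.clientMove { g with active := Function.update g.active c (some T) } c (.start T)
  | .clientTick c => A.clientMove g c .tick
  | .serverTick s => A.serverMove g s none
  | .deliver i =>
      match g.sent[i]? with
      | some ⟨src, Sum.inr s, m⟩ =>
          A.serverMove { g with received := insert i g.received } s (some (src, m))
      | some ⟨Sum.inr s, Sum.inl c, m⟩ =>
          A.clientMove { g with received := insert i g.received } c (.recv s m)
      | _ => { g with received := insert i g.received }

/-- The client, if any, which takes a step in an action, with the trigger of that step. -/
def clientInput (g : Config Obj Val Client Server Msg SState CState) :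
    Action Obj Val Client Server → Option (Client × ClientInput Obj Val Server Msg)
  | .start c T => some (c, .start T)
  | .clientTick c => some (c, .tick)
  | .serverTick _ => none
  | .deliver i =>
      match g.sent[i]? with
      | some ⟨Sum.inr s, Sum.inl c, m⟩ => some (c, .recv s m)
      | _ => none

/-- An execution: an infinite sequence of steps from the initial configuration.  It need not be
fair.  Step `n` leads from configuration `n` to configuration `n + 1`; the index `n` plays the role
of the (global, inaccessible) time.  Every value is written at most once. -/
structure Execution where
  cfg : ℕ → Config Obj Val Client Server Msg SState CState
  act : ℕ → Action Obj Val Client Server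
  cfg_zero : cfg 0 = A.initial
  enabled : ∀ n, Enabled (cfg n) (act n)
  cfg_succ : ∀ n, cfg (n + 1) = A.next (cfg n) (act n)
  unique_writes : ∀ k c T x k' c' T' x' v, act k = .start c T → T.writes x = some v →
    act k' = .start c' T' → T'.writes x' = some v → k = k' ∧ x = x'

namespace Execution

variable {A} (E : A.Execution)

/-- Client `c` starts transaction `T` at step `n`.  A transaction instance (invocation) is
identified by the step at which it starts. -/
def Starts (n : ℕ) (c : Client) (T : Txn Obj Val) : Prop := E.act n = .start c T

/-- The invocation which `c` starts at step `n` is in progress during step `t` (this includes the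
step in which it starts and the step in which it ends). -/
def Running (n : ℕ) (c : Client) (t : ℕ) : Prop :=
  n ≤ t ∧ ∀ k, n < k → k ≤ t → (E.cfg k).active c ≠ none

/-- The invocation which `c` starts at step `n` ends at step `m`, returning `ρ`. -/
def Ends (n : ℕ) (c : Client) (m : ℕ) (ρ : Obj → Option Val) : Prop :=
  E.Running n c m ∧ ∃ inp, clientInput (E.cfg m) (E.act m) = some (c, inp) ∧
    (A.clientStep c ((E.cfg m).clientState c) inp).2.2 = some ρ

/-- At step `t`, process `q` receives message `m`, of index `i`, from process `p`. -/
def Receives (t i : ℕ) (p q : Client ⊕ Server) (m : Msg) : Prop :=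
  E.act t = .deliver i ∧ (E.cfg t).sent[i]? = some ⟨p, q, m⟩

/-- At step `t`, process `p` sends message `m`, of index `i`, to process `q`. -/
def Sends (t i : ℕ) (p q : Client ⊕ Server) (m : Msg) : Prop :=
  (E.cfg t).sent.length ≤ i ∧ (E.cfg (t + 1)).sent[i]? = some ⟨p, q, m⟩

/-! ### Causal consistency -/

end Execution

/-- Read or write. -/
inductive OpKind where
  | read
  | write

/-- An operation `r(x)v` or `w(x)v`, together with the transaction instance that contains it;
`val = none` stands for `⊥`. -/
structure Op (Obj Val : Type*) where
  tx : ℕ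
  kind : OpKind
  obj : Obj
  val : Option Val

namespace Execution

variable {A} (E : A.Execution)

/-- The operation `o` belongs to the history of the first `N` steps.  A write belongs to it as soon
as its transaction has started, a read once its transaction has ended. -/
def IsOp (N : ℕ) (o : Op Obj Val) : Prop :=
  match o.kind with
  | .write => o.tx < N ∧ ∃ c T v, E.Starts o.tx c T ∧ T.writes o.obj = some v ∧ o.val = some v
  | .read => ∃ c T m ρ, E.Starts o.tx c T ∧ E.Ends o.tx c m ρ ∧ m < N ∧
      o.obj ∈ T.reads ∧ o.val = ρ o.obj

/-- Causal precedence between operations of the history of the first `N` steps. -/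
inductive Causal (N : ℕ) : Op Obj Val → Op Obj Val → Prop
  | program {α β : Op Obj Val} (c : Client) (T T' : Txn Obj Val) :
      E.IsOp N α → E.IsOp N β → E.Starts α.tx c T → E.Starts β.tx c T' → α.tx < β.tx →
      Causal N α β
  | readsFrom {α β : Op Obj Val} :
      E.IsOp N α → E.IsOp N β → α.kind = .write → β.kind = .read → α.obj = β.obj →
      α.val = β.val → Causal N α β
  | trans {α γ β : Op Obj Val} : Causal N α γ → Causal N γ β → Causal N α β

/-- The transaction started at step `k < N` contains a write or is a transaction of client `i`. -/
def Ordered (N : ℕ) (i : Client) (k : ℕ) : Prop :=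
  k < N ∧ ∃ c T, E.Starts k c T ∧ (c = i ∨ ∃ x v, T.writes x = some v)

/-- The history of client `i` after the first `N` steps can be causally serialized.  The total
order on the (finitely many) transactions is given by an injective rank `pos`. -/
def CausallySerializable (N : ℕ) (i : Client) : Prop :=
  ∃ pos : ℕ → ℕ, Set.InjOn pos {k | E.Ordered N i k} ∧
    (∀ r v, E.IsOp N r → r.kind = .read → E.Ordered N i r.tx → r.val = some v →
      ∃ w, E.IsOp N w ∧ w.kind = .write ∧ w.obj = r.obj ∧ w.val = some v ∧ pos w.tx < pos r.tx ∧
        ∀ w', E.IsOp N w' → w'.kind = .write → w'.obj = r.obj → pos w'.tx < pos r.tx →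
          pos w'.tx ≤ pos w.tx) ∧
    (∀ r, E.IsOp N r → r.kind = .read → E.Ordered N i r.tx → r.val = none →
      ∀ w, E.IsOp N w → w.kind = .write → w.obj = r.obj → ¬ pos w.tx < pos r.tx) ∧
    (∀ α β, E.Causal N α β → E.Ordered N i α.tx → E.Ordered N i β.tx → pos α.tx < pos β.tx)

/-! ### Fairness -/

/-- An execution of the asynchronous system: every message sent is eventually received, every
server takes local steps forever, and so does every client while it executes a transaction. -/
def Fair : Prop :=
  (∀ n i, i < (E.cfg n).sent.length → ∃ t, E.act t = .deliver i) ∧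
  (∀ s n, ∃ t, n ≤ t ∧ E.act t = .serverTick s) ∧
  (∀ c n, ∃ t, n ≤ t ∧ (E.act t = .clientTick c ∨ (E.cfg t).active c = none))

/-! ### One version -/

open Classical in
/-- The messages which client `c` receives from server `s` in steps `n, …, m`, in order. -/
noncomputable def inbox (c : Client) (s : Server) (n m : ℕ) : List Msg :=
  (List.range' n (m + 1 - n)).filterMap fun t =>
    match E.act t with
    | .deliver i =>
        match (E.cfg t).sent[i]? with
        | some ⟨Sum.inr s', Sum.inl c', msg⟩ => if s' = s ∧ c' = c then some msg else none
        | _ => none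
    | _ => none

/-! ### Fast transactions -/

/-- At step `t`, server `s` receives a message which `c` sent in the invocation started at `n`. -/
def Contact (n : ℕ) (c : Client) (s : Server) (t : ℕ) : Prop :=
  n ≤ t ∧ ∃ i m, E.Receives t i (Sum.inl c) (Sum.inr s) m ∧ (E.cfg n).sent.length ≤ i

/-- Servers do not communicate for the sake of the invocation which `c` starts at step `n`: from
the moment a server has received a message of that invocation and until the invocation ends, the
server receives no message from any server, and any message it sends to a server is delayed. -/
def Isolated (n : ℕ) (c : Client) : Prop :=
  ∀ t i s s' m, E.Running n c t → E.Receives t i (Sum.inr s) (Sum.inr s') m →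
    (∀ t', E.Contact n c s' t' → ¬ t' < t) ∧
    (∀ t', E.Contact n c s t' → t' < t → i < (E.cfg t').sent.length)

/-- Client `c` and the servers keep taking steps, and the messages between `c` and the servers are
eventually received (other messages may be delayed for ever). -/
def FairTo (c : Client) : Prop :=
  (∀ n i s m, ((E.cfg n).sent[i]? = some ⟨Sum.inl c, Sum.inr s, m⟩ ∨
      (E.cfg n).sent[i]? = some ⟨Sum.inr s, Sum.inl c, m⟩) → ∃ t, E.act t = .deliver i) ∧
  (∀ s n, ∃ t, n ≤ t ∧ E.act t = .serverTick s) ∧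
  (∀ n, ∃ t, n ≤ t ∧ (E.act t = .clientTick c ∨ (E.cfg t).active c = none))

/-- The invocation which `c` starts at step `n` uses one communication round: `c` sends at most one
message to each server and receives at most one message from each server, and it sends nothing
once it has received such a message.  (Messages still in transit from earlier invocations of `c`
do not count.) -/
def OneRound (n : ℕ) (c : Client) : Prop :=
  (∀ s t t' i i' m m', E.Running n c t → E.Running n c t' →
    E.Sends t i (Sum.inl c) (Sum.inr s) m → E.Sends t' i' (Sum.inl c) (Sum.inr s) m' → i = i') ∧
  (∀ s t t' i i' m m', E.Running n c t → E.Running n c t' →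
    (E.cfg n).sent.length ≤ i → (E.cfg n).sent.length ≤ i' →
    E.Receives t i (Sum.inr s) (Sum.inl c) m → E.Receives t' i' (Sum.inr s) (Sum.inl c) m' →
    i = i') ∧
  (∀ s s' t t' i i' m m', E.Running n c t → E.Running n c t' → t ≤ t' →
    (E.cfg n).sent.length ≤ i → E.Receives t i (Sum.inr s) (Sum.inl c) m →
    ¬ E.Sends t' i' (Sum.inl c) (Sum.inr s') m')

end Execution

/-- Every transaction ends. -/
def TransactionsEnd : Prop :=
  ∀ E : A.Execution, E.Fair → ∀ n c T, E.Starts n c T → ∃ m ρ, E.Ends n c m ρ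

/-- Servers send messages to a client only if they have received a message from it before. -/
def ServersOnlyRespond : Prop :=
  ∀ (E : A.Execution) t i s c m, E.Sends t i (Sum.inr s) (Sum.inl c) m →
    ∃ t' i' m', t' ≤ t ∧ E.Receives t' i' (Sum.inl c) (Sum.inr s) m'

/-- Servers return one and only one value for each object that is read, and this is the value which
the client returns.  `reveal c σ T s l x` is the value of `x`, if any, that can be read off the
messages `l` which `c` receives from `s` while it executes `T`, having started `T` in the state
`σ`.  No messages reveal no value, so that a client never answers a read from its own memory. -/
def OneVersion (stores : Server → Set Obj) : Prop :=
  ∃ reveal : Client → CState → Txn Obj Val → Server → List Msg → Obj → Option (Option Val),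
    (∀ c σ T s x, reveal c σ T s [] x = none) ∧
    ∀ (E : A.Execution) n c T m ρ, E.Starts n c T → E.Ends n c m ρ → ∀ x ∈ T.reads,
      (∃ s, x ∈ stores s ∧
        reveal c ((E.cfg n).clientState c) T s (E.inbox c s n m) x = some (ρ x)) ∧
      (∀ s v, x ∈ stores s →
        reveal c ((E.cfg n).clientState c) T s (E.inbox c s n m) x = some v → v = ρ x)

/-- Causal consistency: at any point of any execution, each client's history can be causally
serialized. -/
def CausallyConsistent : Prop :=
  ∀ (E : A.Execution) N i, E.CausallySerializable N i

/-- Progress: for any write `w(x)v`, by a transaction started at step `k`, there is a time `τ` such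
that any read of `x` that starts at or after `τ` returns `v` or a value whose write returns no
earlier than step `k`. -/
def Progress : Prop :=
  ∀ E : A.Execution, E.Fair → ∀ k c T x v, E.Starts k c T → T.writes x = some v →
    ∃ τ, ∀ k' c' T' m ρ, τ ≤ k' → E.Starts k' c' T' → x ∈ T'.reads → E.Ends k' c' m ρ →
      ρ x = some v ∨
      ∃ u k₁ c₁ T₁, ρ x = some u ∧ E.Starts k₁ c₁ T₁ ∧ T₁.writes x = some u ∧
        ∀ m₁ ρ₁, E.Ends k₁ c₁ m₁ ρ₁ → k ≤ m₁

/-- Transaction `T` is fast: whenever it is invoked and however messages are scheduled, if servers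
do not communicate for its sake, then it ends, after one communication round. -/
def Fast (T : Txn Obj Val) : Prop :=
  ∀ (E : A.Execution) n c, E.Starts n c T → E.FairTo c → E.Isolated n c →
    (∃ m ρ, E.Ends n c m ρ) ∧ E.OneRound n c

/-- The implementation provides fast read-only transactions. -/
def FastReadOnly : Prop := ∀ T : Txn Obj Val, T.ReadOnly → A.Fast T

end Protocol

end CausalStorage

namespace CausalStorage
namespace Protocol

variable {Obj Val Client Server Msg SState CState : Type*}
  {A : Protocol Obj Val Client Server Msg SState CState}

/-! Let `Tw` write pairwise distinct values to all objects, let `T` read all objects, and consider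
executions in which no transaction writes except possibly `Tw`, at step 0 (`SingleWrite`). A fresh
client, one that has requested nothing so far, runs `T` while the servers receive messages from it
only. Since `T` is fast, the client sends nothing after an answer has arrived, so its requests are
those of a solo run, and each server gets at most one of them. Hence what a server may answer
depends only on the state of that server when `T` starts. `Reply` collects these possible answers,
and `ends_with_replies` shows that the values read are revealed by them.

Possible answers of two different servers at the same moment can be delivered in one invocation,
which cannot end before both have arrived if they are the first two, because no server stores all
objects (`exists_mixed_read`). Causal consistency forbids that such a read returns `⊥` for one
object and a written value for another, as a single transaction writes them all (`exists_write`). So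
one possible answer that reveals an initial value forces all possible answers at that moment to
reveal initial values only (`onlyInitial_of_witness`).

A step changes the state of at most one server. An object not stored there can be answered by
another server, whose possible answers are the same before and after the step. By induction on the
steps, a fresh client never sees a written value (`onlyInitial`).

It remains to build a fair execution in which `Tw` is requested and infinitely many fresh clients
then run `T` in isolation (`ReadingExecution`). All of them read `⊥`, which contradicts progress
(`FastStorage.not_progress`). -/

/-- The server, if any, which takes a step in an action, with the trigger of that step. -/
def serverInput (g : Config Obj Val Client Server Msg SState CState) :
    Action Obj Val Client Server → Option (Server × Option ((Client ⊕ Server) × Msg))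
  | .start _ _ => none
  | .clientTick _ => none
  | .serverTick s => some (s, none)
  | .deliver i =>
      match g.sent[i]? with
      | some ⟨p, Sum.inr s, m⟩ => some (s, some (p, m))
      | _ => none

/-- The message of index `i` has been sent, from `p` to `q`, but not yet received. -/
def Pending (g : Config Obj Val Client Server Msg SState CState) (i : ℕ) (p q : Client ⊕ Server)
    (m : Msg) : Prop :=
  g.sent[i]? = some ⟨p, q, m⟩ ∧ i ∉ g.received

/-! ### Effect of a single action on a configuration -/

section Steps

variable (g : Config Obj Val Client Server Msg SState CState)

/-- The four kinds of effect which an action can have. -/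
theorem next_cases (a : Action Obj Val Client Server) :
    (∃ s inp g', serverInput g a = some (s, inp) ∧ clientInput g a = none ∧
      A.next g a = A.serverMove g' s inp ∧ g'.serverState = g.serverState ∧
      g'.clientState = g.clientState ∧ g'.active = g.active ∧ g'.sent = g.sent) ∨
    (∃ c inp g', serverInput g a = none ∧ clientInput g a = some (c, inp) ∧
      A.next g a = A.clientMove g' c inp ∧ g'.serverState = g.serverState ∧
      g'.clientState = g.clientState ∧ (∀ c', c' ≠ c → g'.active c' = g.active c') ∧
      ((∀ T, inp ≠ .start T) → g'.active = g.active) ∧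
      (∀ T, inp = .start T → a = .start c T ∧ g'.active c = some T) ∧ g'.sent = g.sent) ∨
    (serverInput g a = none ∧ clientInput g a = none ∧
      (A.next g a).serverState = g.serverState ∧ (A.next g a).clientState = g.clientState ∧
      (A.next g a).active = g.active ∧ (A.next g a).sent = g.sent) := by
  classical
  cases a with
  | start c T =>
    right; left
    refine ⟨c, .start T, _, rfl, rfl, rfl, rfl, rfl, fun c' h => ?_, fun h => absurd rfl (h T),
      fun T' h => ?_, rfl⟩
    · simp [h]
    · cases h; simp
  | clientTick c =>
    right; left
    exact ⟨c, .tick, _, rfl, rfl, rfl, rfl, rfl, fun _ _ => rfl, fun _ => rfl,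
      fun T' h => by simp at h, rfl⟩
  | serverTick s =>
    left
    exact ⟨s, none, _, rfl, rfl, rfl, rfl, rfl, rfl, rfl⟩
  | deliver i =>
    rcases hm : g.sent[i]? with _ | ⟨p | p, q | q, m⟩
    · right; right; simp [serverInput, clientInput, next, hm]
    · right; right; simp [serverInput, clientInput, next, hm]
    · left
      exact ⟨q, some (Sum.inl p, m), { g with received := insert i g.received },
        by simp [serverInput, hm], by simp [clientInput, hm], by simp [next, hm],
        rfl, rfl, rfl, rfl⟩
    · right; left
      exact ⟨q, .recv p m, { g with received := insert i g.received },
        by simp [serverInput, hm], by simp [clientInput, hm], by simp [next, hm], rfl, rfl,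
        fun _ _ => rfl, fun _ => rfl, fun T' h => by simp at h, rfl⟩
    · left
      exact ⟨q, some (Sum.inr p, m), { g with received := insert i g.received },
        by simp [serverInput, hm], by simp [clientInput, hm], by simp [next, hm],
        rfl, rfl, rfl, rfl⟩

theorem clientMove_sent (c : Client) (inp : ClientInput Obj Val Server Msg) :
    ∃ l, (A.clientMove g c inp).sent = g.sent ++ l ∧
      ∀ e ∈ l, g.active c ≠ none ∧ ∃ p ∈ (A.clientStep c (g.clientState c) inp).2.1,
        e = ⟨Sum.inl c, Sum.inr p.1, p.2⟩ := by
  unfold clientMove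
  split_ifs with h
  · exact ⟨[], by simp, by simp⟩
  · refine ⟨_, rfl, fun e he => ⟨h, ?_⟩⟩
    obtain ⟨p, hp, rfl⟩ := List.mem_map.1 he
    exact ⟨p, hp, rfl⟩

theorem clientMove_clientState_self (c : Client) (inp : ClientInput Obj Val Server Msg) :
    (A.clientMove g c inp).clientState c = (A.clientStep c (g.clientState c) inp).1 := by
  unfold clientMove
  split_ifs <;> simp

theorem clientMove_clientState_of_ne {c c' : Client} (h : c' ≠ c)
    (inp : ClientInput Obj Val Server Msg) :
    (A.clientMove g c inp).clientState c' = g.clientState c' := by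
  unfold clientMove
  split_ifs <;> simp [h]

theorem clientMove_active_of_ne {c c' : Client} (h : c' ≠ c)
    (inp : ClientInput Obj Val Server Msg) :
    (A.clientMove g c inp).active c' = g.active c' := by
  unfold clientMove
  dsimp only
  split_ifs <;> simp [h]

theorem clientMove_active_self {c : Client} {inp : ClientInput Obj Val Server Msg}
    (h : (A.clientStep c (g.clientState c) inp).2.2 = none) :
    (A.clientMove g c inp).active c = g.active c := by
  unfold clientMove
  split_ifs <;> simp_all

theorem clientMove_active_eq_none {c : Client} {inp : ClientInput Obj Val Server Msg}
    (h : (A.clientStep c (g.clientState c) inp).2.2 ≠ none) :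
    (A.clientMove g c inp).active c = none := by
  unfold clientMove
  split_ifs with h1
  · exact h1
  · simp [Option.isSome_iff_ne_none.2 h]

theorem clientMove_serverState (c : Client) (inp : ClientInput Obj Val Server Msg) :
    (A.clientMove g c inp).serverState = g.serverState := by
  unfold clientMove
  split_ifs <;> rfl

theorem clientMove_received (c : Client) (inp : ClientInput Obj Val Server Msg) :
    (A.clientMove g c inp).received = g.received := by
  unfold clientMove
  split_ifs <;> rfl

theorem clientMove_sent_of_active {c : Client} (inp : ClientInput Obj Val Server Msg)
    (h : g.active c ≠ none) :
    (A.clientMove g c inp).sent = g.sent ++ (A.clientStep c (g.clientState c) inp).2.1.map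
      (fun p => ⟨Sum.inl c, Sum.inr p.1, p.2⟩) := by
  unfold clientMove
  rw [if_neg h]

theorem next_received_subset (a : Action Obj Val Client Server) {i : ℕ}
    (h : i ∈ (A.next g a).received) : i ∈ g.received ∨ a = .deliver i := by
  cases a with
  | start c T => left; simpa [next, clientMove_received] using h
  | clientTick c => left; simpa [next, clientMove_received] using h
  | serverTick s => left; simpa [next, serverMove] using h
  | deliver j =>
    have : (A.next g (.deliver j)).received = insert j g.received := by
      rcases hm : g.sent[j]? with _ | ⟨p | p, q | q, m⟩ <;>
        simp [next, hm, clientMove_received, serverMove]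
    rw [this] at h
    rcases h with rfl | h
    · exact Or.inr rfl
    · exact Or.inl h

theorem next_deliver_received (j : ℕ) : j ∈ (A.next g (.deliver j)).received := by
  rcases hm : g.sent[j]? with _ | ⟨p | p, q | q, m⟩ <;>
    simp [next, hm, clientMove_received, serverMove]

theorem subset_next_received (a : Action Obj Val Client Server) :
    g.received ⊆ (A.next g a).received := by
  intro i h
  cases a with
  | start c T => simpa [next, clientMove_received] using h
  | clientTick c => simpa [next, clientMove_received] using h
  | serverTick s => simpa [next, serverMove] using h
  | deliver j =>
    rcases hm : g.sent[j]? with _ | ⟨p | p, q | q, m⟩ <;>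
      simp [next, hm, clientMove_received, serverMove, h]

/-- The messages sent in a step, with the process that sends them. -/
theorem next_sent (a : Action Obj Val Client Server) :
    ∃ l, (A.next g a).sent = g.sent ++ l ∧ ∀ e ∈ l,
      (∃ s inp d m, serverInput g a = some (s, inp) ∧ e = ⟨Sum.inr s, d, m⟩ ∧
        (d, m) ∈ (A.serverStep s (g.serverState s) inp).2) ∨
      (∃ c inp s m, clientInput g a = some (c, inp) ∧ e = ⟨Sum.inl c, Sum.inr s, m⟩ ∧
        (s, m) ∈ (A.clientStep c (g.clientState c) inp).2.1 ∧
        ((∃ T, a = .start c T) ∨ g.active c ≠ none)) := by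
  rcases next_cases (A := A) g a with
    ⟨s, inp, g', h1, h2, h3, h4, h5, h6, h7⟩ | ⟨c, inp, g', h1, h2, h3, h4, h5, h6, h7, h8, h9⟩ |
    ⟨h1, h2, h3, h4, h5, h6⟩
  · refine ⟨(A.serverStep s (g.serverState s) inp).2.map (fun p => ⟨Sum.inr s, p.1, p.2⟩), ?_, ?_⟩
    · rw [h3]; simp [serverMove, h4, h7]
    · intro e he
      obtain ⟨p, hp, rfl⟩ := List.mem_map.1 he
      exact Or.inl ⟨s, inp, p.1, p.2, h1, rfl, hp⟩
  · obtain ⟨l, hl, hl'⟩ := clientMove_sent (A := A) g' c inp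
    refine ⟨l, by rw [h3, hl, h9], fun e he => Or.inr ?_⟩
    obtain ⟨h, p, hp, rfl⟩ := hl' e he
    refine ⟨c, inp, p.1, p.2, h2, rfl, by rwa [h5] at hp, ?_⟩
    by_cases hT : ∃ T, inp = .start T
    · obtain ⟨T, hT⟩ := hT
      exact Or.inl ⟨T, (h8 T hT).1⟩
    · push Not at hT
      rw [h7 hT] at h
      exact Or.inr h
  · exact ⟨[], by simp [h6], by simp⟩

theorem next_serverState_of_none {a : Action Obj Val Client Server} {s : Server}
    (h : ∀ inp, serverInput g a ≠ some (s, inp)) :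
    (A.next g a).serverState s = g.serverState s := by
  rcases next_cases (A := A) g a with
    ⟨s', inp, g', h1, h2, h3, h4, h5, h6, h7⟩ | ⟨c, inp, g', h1, h2, h3, h4, h5, h6, h7, h8, h9⟩ |
    ⟨h1, h2, h3, h4, h5, h6⟩
  · have : s ≠ s' := by rintro rfl; exact h _ h1
    rw [h3]; simp [serverMove, this, h4]
  · rw [h3, clientMove_serverState, h4]
  · rw [h3]

theorem next_serverState {a : Action Obj Val Client Server} {s : Server}
    {inp : Option ((Client ⊕ Server) × Msg)} (h : serverInput g a = some (s, inp)) :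
    (A.next g a).serverState s = (A.serverStep s (g.serverState s) inp).1 ∧
    (A.next g a).sent = g.sent ++
      (A.serverStep s (g.serverState s) inp).2.map (fun p => ⟨Sum.inr s, p.1, p.2⟩) := by
  rcases next_cases (A := A) g a with
    ⟨s', inp', g', h1, h2, h3, h4, h5, h6, h7⟩ | ⟨c, inp, g', h1, h2, h3, h4, h5, h6, h7, h8, h9⟩ |
    ⟨h1, h2, h3, h4, h5, h6⟩
  · rw [h1] at h; cases h
    rw [h3]; simp [serverMove, h4, h7]
  · rw [h1] at h; cases h
  · rw [h1] at h; cases h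

theorem next_clientState_of_none {a : Action Obj Val Client Server} {c : Client}
    (h : ∀ inp, clientInput g a ≠ some (c, inp)) :
    (A.next g a).clientState c = g.clientState c ∧ (A.next g a).active c = g.active c := by
  rcases next_cases (A := A) g a with
    ⟨s', inp, g', h1, h2, h3, h4, h5, h6, h7⟩ | ⟨c', inp, g', h1, h2, h3, h4, h5, h6, h7, h8, h9⟩ |
    ⟨h1, h2, h3, h4, h5, h6⟩
  · rw [h3]; simp [serverMove, h5, h6]
  · have : c ≠ c' := by rintro rfl; exact h _ h2
    rw [h3, clientMove_clientState_of_ne _ this, clientMove_active_of_ne _ this, h5, h6 _ this]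
    exact ⟨rfl, rfl⟩
  · rw [h4, h5]; exact ⟨rfl, rfl⟩

theorem next_clientState {a : Action Obj Val Client Server} {c : Client}
    {inp : ClientInput Obj Val Server Msg} (h : clientInput g a = some (c, inp)) :
    (A.next g a).clientState c = (A.clientStep c (g.clientState c) inp).1 := by
  rcases next_cases (A := A) g a with
    ⟨s', inp', g', h1, h2, h3, h4, h5, h6, h7⟩ | ⟨c', inp', g', h1, h2, h3, h4, h5, h6, h7, h8, h9⟩ |
    ⟨h1, h2, h3, h4, h5, h6⟩
  · rw [h2] at h; cases h
  · rw [h2] at h; cases h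
    rw [h3, clientMove_clientState_self, h5]
  · rw [h2] at h; cases h

theorem next_active_eq_none {a : Action Obj Val Client Server} {c : Client}
    {inp : ClientInput Obj Val Server Msg} (h : clientInput g a = some (c, inp))
    (hr : (A.clientStep c (g.clientState c) inp).2.2 ≠ none) : (A.next g a).active c = none := by
  rcases next_cases (A := A) g a with
    ⟨s', inp', g', h1, h2, h3, h4, h5, h6, h7⟩ | ⟨c', inp', g', h1, h2, h3, h4, h5, h6, h7, h8, h9⟩ |
    ⟨h1, h2, h3, h4, h5, h6⟩
  · rw [h2] at h; cases h
  · rw [h2] at h; cases h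
    rw [h3, clientMove_active_eq_none]
    rwa [h5]
  · rw [h2] at h; cases h

/-- A client becomes active only by a request. -/
theorem next_active_of_none {a : Action Obj Val Client Server} {c : Client}
    (h : ∀ T, a ≠ .start c T) (hc : g.active c = none) : (A.next g a).active c = none := by
  by_cases h' : ∀ inp, clientInput g a ≠ some (c, inp)
  · rw [(next_clientState_of_none g h').2, hc]
  push Not at h'
  obtain ⟨inp, hi⟩ := h'
  rcases next_cases (A := A) g a with
    ⟨s', inp', g', h1, h2, h3, h4, h5, h6, h7⟩ | ⟨c', inp', g', h1, h2, h3, h4, h5, h6, h7, h8, h9⟩ |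
    ⟨h1, h2, h3, h4, h5, h6⟩
  · rw [h2] at hi; cases hi
  · rw [h2] at hi; cases hi
    have hg : g'.active c = none := by
      rw [h7 fun T hT => h T (h8 T hT).1, hc]
    rw [h3]; unfold clientMove; simp [hg]
  · rw [h2] at hi; cases hi

theorem pending_next {a : Action Obj Val Client Server} {i : ℕ} {p q : Client ⊕ Server} {m : Msg}
    (h : Pending g i p q m) (ha : a ≠ .deliver i) : Pending (A.next g a) i p q m := by
  obtain ⟨l, hl, -⟩ := next_sent (A := A) g a
  refine ⟨?_, fun hi => ?_⟩
  · rw [hl]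
    exact List.getElem?_append_left (List.getElem?_eq_some_iff.1 h.1).1 ▸ h.1
  · rcases next_received_subset g a hi with h' | h'
    · exact h.2 h'
    · exact ha h'

theorem Pending.enabled {i : ℕ} {p q : Client ⊕ Server} {m : Msg} (h : Pending g i p q m) :
    Enabled g (.deliver i : Action Obj Val Client Server) :=
  ⟨(List.getElem?_eq_some_iff.1 h.1).1, h.2⟩

end Steps

/-! ### Messages and invocations along an execution -/

namespace Execution

variable (E : A.Execution)

theorem sent_prefix {n k : ℕ} (h : n ≤ k) : ∃ l, (E.cfg k).sent = (E.cfg n).sent ++ l := by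
  induction k, h using Nat.le_induction with
  | base => exact ⟨[], by simp⟩
  | succ k _ ih =>
    obtain ⟨l, hl⟩ := ih
    obtain ⟨l', hl', -⟩ := next_sent (A := A) (E.cfg k) (E.act k)
    exact ⟨l ++ l', by rw [E.cfg_succ, hl', hl, List.append_assoc]⟩

theorem sent_length_mono {n k : ℕ} (h : n ≤ k) :
    (E.cfg n).sent.length ≤ (E.cfg k).sent.length := by
  obtain ⟨l, hl⟩ := E.sent_prefix h
  simp [hl]

theorem sent_stable {n k i : ℕ} (h : n ≤ k) {e : Envelope Client Server Msg}
    (hi : (E.cfg n).sent[i]? = some e) : (E.cfg k).sent[i]? = some e := by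
  obtain ⟨l, hl⟩ := E.sent_prefix h
  rw [hl, List.getElem?_append_left (List.getElem?_eq_some_iff.1 hi).1, hi]

theorem sent_back {n k i : ℕ} (h : n ≤ k) {e : Envelope Client Server Msg}
    (hi : (E.cfg k).sent[i]? = some e) (hn : i < (E.cfg n).sent.length) :
    (E.cfg n).sent[i]? = some e := by
  obtain ⟨l, hl⟩ := E.sent_prefix h
  rwa [hl, List.getElem?_append_left hn] at hi

theorem received_mono {n k : ℕ} (h : n ≤ k) : (E.cfg n).received ⊆ (E.cfg k).received := by
  induction k, h using Nat.le_induction with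
  | base => exact subset_rfl
  | succ k _ ih =>
    rw [E.cfg_succ]
    exact ih.trans (subset_next_received _ _)

theorem exists_deliver_of_received {n i : ℕ} (h : i ∈ (E.cfg n).received) :
    ∃ t, t < n ∧ E.act t = .deliver i := by
  induction n with
  | zero => simp [E.cfg_zero, initial] at h
  | succ n ih =>
    rw [E.cfg_succ] at h
    rcases next_received_subset _ _ h with h | h
    · obtain ⟨t, ht, h'⟩ := ih h
      exact ⟨t, by omega, h'⟩
    · exact ⟨n, by omega, h⟩

theorem lt_length_of_received {n i : ℕ} (h : i ∈ (E.cfg n).received) :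
    i < (E.cfg n).sent.length := by
  obtain ⟨t, ht, h'⟩ := E.exists_deliver_of_received h
  have := E.enabled t
  rw [h'] at this
  exact this.1.trans_le (E.sent_length_mono ht.le)

theorem deliver_unique {t t' i : ℕ} (h : E.act t = .deliver i) (h' : E.act t' = .deliver i) :
    t = t' := by
  wlog hlt : t < t' generalizing t t'
  · rcases Nat.lt_trichotomy t t' with h1 | h1 | h1
    · exact this h h' h1
    · exact h1
    · exact (this h' h h1).symm
  exfalso
  have h1 := E.enabled t'
  rw [h'] at h1
  apply h1.2
  apply E.received_mono hlt
  rw [E.cfg_succ, h]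
  exact next_deliver_received _ _

/-- Every message has been sent at some step. -/
theorem exists_sends {a b i : ℕ} {p q : Client ⊕ Server} {m : Msg} (hab : a ≤ b)
    (ha : (E.cfg a).sent.length ≤ i) (hb : (E.cfg b).sent[i]? = some ⟨p, q, m⟩) :
    ∃ t, a ≤ t ∧ t < b ∧ E.Sends t i p q m := by
  induction b, hab using Nat.le_induction with
  | base =>
    rw [List.getElem?_eq_none ha] at hb
    cases hb
  | succ b hab ih =>
    by_cases h : i < (E.cfg b).sent.length
    · obtain ⟨t, h1, h2, h3⟩ := ih (E.sent_back (Nat.le_succ b) hb h)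
      exact ⟨t, h1, by omega, h3⟩
    · exact ⟨b, hab, by omega, by omega, hb⟩

theorem Sends.mem {E : A.Execution} {t i : ℕ} {p q : Client ⊕ Server} {m : Msg}
    (h : E.Sends t i p q m) :
    (∃ s inp, serverInput (E.cfg t) (E.act t) = some (s, inp) ∧ p = Sum.inr s ∧
        (q, m) ∈ (A.serverStep s ((E.cfg t).serverState s) inp).2) ∨
    (∃ c inp s, clientInput (E.cfg t) (E.act t) = some (c, inp) ∧ p = Sum.inl c ∧ q = Sum.inr s ∧
        (s, m) ∈ (A.clientStep c ((E.cfg t).clientState c) inp).2.1 ∧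
        ((∃ T, E.act t = .start c T) ∨ (E.cfg t).active c ≠ none)) := by
  obtain ⟨h1, h2⟩ := h
  obtain ⟨l, hl, hl'⟩ := next_sent (A := A) (E.cfg t) (E.act t)
  rw [E.cfg_succ, hl, List.getElem?_append_right h1] at h2
  rcases hl' _ (List.mem_of_getElem? h2) with ⟨s, inp, d, m', h3, h4, h5⟩ |
    ⟨c, inp, s, m', h3, h4, h5, h6⟩
  · cases h4; exact Or.inl ⟨s, inp, h3, rfl, h5⟩
  · cases h4; exact Or.inr ⟨c, inp, s, h3, rfl, rfl, h5, h6⟩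

theorem Running.mono {E : A.Execution} {n t t' : ℕ} {c : Client} (h : E.Running n c t)
    (hn : n ≤ t') (ht : t' ≤ t) : E.Running n c t' :=
  ⟨hn, fun k h1 h2 => h.2 k h1 (h2.trans ht)⟩

/-- The invocation is over after the step in which it ends. -/
theorem Ends.le {E : A.Execution} {n m t : ℕ} {c : Client} {ρ : Obj → Option Val}
    (h : E.Ends n c m ρ) (ht : E.Running n c t) : t ≤ m := by
  by_contra hlt
  obtain ⟨hr, inp, h1, h2⟩ := h
  have h3 := ht.2 (m + 1) (by have := hr.1; omega) (by omega)
  rw [E.cfg_succ] at h3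
  exact h3 (next_active_eq_none _ h1 (by simp [h2]))

theorem clientInput_recv {t : ℕ} {c : Client} {s : Server} {m : Msg}
    (h : clientInput (E.cfg t) (E.act t) = some (c, .recv s m)) :
    ∃ i, E.Receives t i (Sum.inr s) (Sum.inl c) m := by
  unfold Receives
  generalize E.act t = a at *
  cases a with
  | start c T => simp [clientInput] at h
  | clientTick c => simp [clientInput] at h
  | serverTick s => simp [clientInput] at h
  | deliver i =>
    rcases hm : (E.cfg t).sent[i]? with _ | ⟨p | p, q | q, m⟩ <;> simp [clientInput, hm] at h
    obtain ⟨rfl, rfl, rfl⟩ := h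
    exact ⟨i, rfl, hm⟩

theorem clientInput_start {t : ℕ} {c : Client} {T : Txn Obj Val}
    (h : clientInput (E.cfg t) (E.act t) = some (c, .start T)) : E.act t = .start c T := by
  generalize E.act t = a at *
  cases a with
  | start c T => simp [clientInput] at h; simp [h]
  | clientTick c => simp [clientInput] at h
  | serverTick s => simp [clientInput] at h
  | deliver i =>
    rcases hm : (E.cfg t).sent[i]? with _ | ⟨p | p, q | q, m⟩ <;> simp [clientInput, hm] at h

theorem clientInput_tick {t : ℕ} {c : Client}
    (h : clientInput (E.cfg t) (E.act t) = some (c, .tick)) : E.act t = .clientTick c := by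
  generalize E.act t = a at *
  cases a with
  | start c T => simp [clientInput] at h
  | clientTick c => simp [clientInput] at h; simp [h]
  | serverTick s => simp [clientInput] at h
  | deliver i =>
    rcases hm : (E.cfg t).sent[i]? with _ | ⟨p | p, q | q, m⟩ <;> simp [clientInput, hm] at h

theorem serverInput_some {t : ℕ} {p : Client ⊕ Server} {s : Server} {m : Msg}
    (h : serverInput (E.cfg t) (E.act t) = some (s, some (p, m))) :
    ∃ i, E.Receives t i p (Sum.inr s) m := by
  unfold Receives
  generalize E.act t = a at *
  cases a with
  | start c T => simp [serverInput] at h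
  | clientTick c => simp [serverInput] at h
  | serverTick s => simp [serverInput] at h
  | deliver i =>
    rcases hm : (E.cfg t).sent[i]? with _ | ⟨p' | p', q | q, m⟩ <;> simp [serverInput, hm] at h
    all_goals
      obtain ⟨rfl, rfl, rfl⟩ := h
      exact ⟨i, rfl, hm⟩

theorem Receives.serverInput {E : A.Execution} {t i : ℕ} {p : Client ⊕ Server} {s : Server}
    {m : Msg} (h : E.Receives t i p (Sum.inr s) m) :
    serverInput (E.cfg t) (E.act t) = some (s, some (p, m)) := by
  obtain ⟨h1, h2⟩ := h
  simp [Protocol.serverInput, h1, h2]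

/-! ### Fresh clients and executions with a common prefix -/

/-- Client `c` has not requested any transaction before step `n`. -/
def Fresh (n : ℕ) (c : Client) : Prop := ∀ k T, k < n → ¬ E.Starts k c T

variable {E}

theorem Fresh.mono {n k : ℕ} {c : Client} (h : E.Fresh n c) (hk : k ≤ n) : E.Fresh k c :=
  fun j T hj => h j T (hj.trans_le hk)

theorem Fresh.active {n : ℕ} {c : Client} (h : E.Fresh n c) : (E.cfg n).active c = none := by
  induction n with
  | zero => simp [E.cfg_zero, initial]
  | succ n ih =>
    rw [E.cfg_succ]
    exact next_active_of_none _ (fun T => h n T (by omega)) (ih (h.mono (by omega)))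

/-- A client sends only in a step that starts a transaction or while it is active, and a fresh
client has had neither. -/
theorem Fresh.not_sent_by {n i : ℕ} {c : Client} (h : E.Fresh n c) {q : Client ⊕ Server} {m : Msg} :
    (E.cfg n).sent[i]? ≠ some ⟨Sum.inl c, q, m⟩ := by
  intro hi
  obtain ⟨t, -, ht, hs⟩ := E.exists_sends (Nat.zero_le n) (by simp [E.cfg_zero, initial]) hi
  rcases hs.mem with ⟨s, inp, h1, h2, h3⟩ | ⟨c, inp, s, h1, h2, h3, h4, h5⟩
  · cases h2
  · cases h2
    rcases h5 with ⟨T, hT⟩ | h5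
    · exact h t T ht hT
    · exact h5 (h.mono ht.le).active

/-- A message to `c` would presuppose an earlier message from `c`. -/
theorem Fresh.not_sent_to (hrespond : A.ServersOnlyRespond) {n i : ℕ} {c : Client}
    (h : E.Fresh n c) {p : Client ⊕ Server} {m : Msg} :
    (E.cfg n).sent[i]? ≠ some ⟨p, Sum.inl c, m⟩ := by
  intro hi
  obtain ⟨t, -, ht, hs⟩ := E.exists_sends (Nat.zero_le n) (by simp [E.cfg_zero, initial]) hi
  rcases hs.mem with ⟨s, inp, h1, rfl, h3⟩ | ⟨c', inp, s, h1, h2, h3, h4, h5⟩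
  · obtain ⟨t', i', m', ht', hr⟩ := hrespond E t i s c m hs
    exact (h.mono (by omega : t' ≤ n)).not_sent_by hr.2
  · cases h3

/-- A step of `c` would be a request (not made yet), a reception (nothing was sent to `c`) or a
local step (not enabled while inactive). Thus the first transaction of a client starts in a state
that does not depend on the execution. -/
theorem Fresh.clientState (hrespond : A.ServersOnlyRespond) {n : ℕ} {c : Client}
    (h : E.Fresh n c) : (E.cfg n).clientState c = A.clientInit c := by
  induction n with
  | zero => simp [E.cfg_zero, initial]
  | succ n ih =>
    have hn := h.mono (Nat.le_succ n)
    rw [E.cfg_succ, (next_clientState_of_none _ _).1, ih hn]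
    rintro (T | ⟨s, m⟩ | _) hinp
    · exact h n T (by omega) (E.clientInput_start hinp)
    · obtain ⟨i, hi⟩ := E.clientInput_recv hinp
      exact hn.not_sent_to hrespond hi.2
    · have := E.enabled n
      rw [E.clientInput_tick hinp] at this
      exact this hn.active

/-- The executions `E` and `E'` have the same first `n` steps. -/
def AgreeTo (n : ℕ) (E E' : A.Execution) : Prop := ∀ i, i < n → E'.act i = E.act i

theorem AgreeTo.cfg {E' : A.Execution} {n i : ℕ} (h : AgreeTo n E E') (hi : i ≤ n) :
    E'.cfg i = E.cfg i := by
  induction i with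
  | zero => rw [E.cfg_zero, E'.cfg_zero]
  | succ i ih => rw [E.cfg_succ, E'.cfg_succ, ih (by omega), h i (by omega)]

theorem AgreeTo.trans {E' E'' : A.Execution} {n k : ℕ} (h : AgreeTo n E E')
    (h' : AgreeTo k E' E'') (hk : n ≤ k) : AgreeTo n E E'' :=
  fun i hi => (h' i (by omega)).trans (h i hi)

theorem AgreeTo.fresh {E' : A.Execution} {n : ℕ} {c : Client} (h : AgreeTo n E E')
    (hf : E.Fresh n c) : E'.Fresh n c :=
  fun k T hk hs => hf k T hk ((h k hk).symm.trans hs)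

theorem AgreeTo.receives {E' : A.Execution} {n t i : ℕ} {p q : Client ⊕ Server} {m : Msg}
    (h : AgreeTo n E E') (ht : t < n) : E'.Receives t i p q m ↔ E.Receives t i p q m := by
  unfold Receives
  rw [h t ht, h.cfg ht.le]

/-- No transaction writes, except possibly the first one, which is then `Tw`. -/
def SingleWrite (Tw : Txn Obj Val) (E : A.Execution) : Prop :=
  ∀ k c T, E.Starts k c T → T.ReadOnly ∨ (k = 0 ∧ T = Tw)

end Execution

/-! ### Executions built from schedulers -/

open Classical in
/-- Action `a` if it is possible, and a local step of server `s` otherwise. -/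
noncomputable def guarded (s : Server) (g : Config Obj Val Client Server Msg SState CState)
    (a : Action Obj Val Client Server) : Action Obj Val Client Server :=
  if Enabled g a then a else .serverTick s

theorem guarded_of_enabled {s : Server} {g : Config Obj Val Client Server Msg SState CState}
    {a : Action Obj Val Client Server} (h : Enabled g a) : guarded s g a = a := if_pos h

theorem enabled_guarded (s : Server) (g : Config Obj Val Client Server Msg SState CState)
    (a : Action Obj Val Client Server) : Enabled g (guarded s g a) := by
  unfold guarded
  split_ifs with h
  · exact h
  · trivial

theorem guarded_cases (s : Server) (g : Config Obj Val Client Server Msg SState CState)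
    (a : Action Obj Val Client Server) :
    guarded s g a = a ∨ guarded s g a = .serverTick s := by
  unfold guarded
  split_ifs <;> simp

/-- The configurations reached by a scheduler `f` with an internal state, together with the states
of the scheduler. -/
noncomputable def schedule {ι : Type*} (A : Protocol Obj Val Client Server Msg SState CState)
    (s : Server) (f : ℕ → ι → Config Obj Val Client Server Msg SState CState →
      Action Obj Val Client Server × ι) (x : ι) :
    ℕ → Config Obj Val Client Server Msg SState CState × ι
  | 0 => (A.initial, x)
  | n + 1 =>
    let r := schedule A s f x n
    (A.next r.1 (guarded s r.1 (f n r.2 r.1).1), (f n r.2 r.1).2)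

/-- The guard makes every scheduled action possible. Values are written at most once because only
step 0 can request a writing transaction, namely `Tw`, whose values determine their objects. -/
theorem exists_execution {ι : Type*} (s : Server) {Tw : Txn Obj Val}
    (hTw : ∀ x x' v, Tw.writes x = some v → Tw.writes x' = some v → x = x')
    (f : ℕ → ι → Config Obj Val Client Server Msg SState CState →
      Action Obj Val Client Server × ι) (x : ι)
    (hf : ∀ n y g c T, (f n y g).1 = .start c T → T.ReadOnly ∨ (n = 0 ∧ T = Tw)) :
    ∃ (E : A.Execution) (σ : ℕ → ι), Execution.SingleWrite Tw E ∧ σ 0 = x ∧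
      ∀ n, E.act n = guarded s (E.cfg n) (f n (σ n) (E.cfg n)).1 ∧
        σ (n + 1) = (f n (σ n) (E.cfg n)).2 := by
  have hsingle : ∀ k c T, guarded s (schedule A s f x k).1
      (f k (schedule A s f x k).2 (schedule A s f x k).1).1 = .start c T →
      T.ReadOnly ∨ (k = 0 ∧ T = Tw) := by
    intro k c T h
    rcases guarded_cases s (schedule A s f x k).1
      (f k (schedule A s f x k).2 (schedule A s f x k).1).1 with h' | h'
    · exact hf _ _ _ _ _ (h'.symm.trans h)
    · rw [h'] at h; cases h
  refine ⟨{ cfg := fun n => (schedule A s f x n).1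
            act := fun n => guarded s (schedule A s f x n).1
              (f n (schedule A s f x n).2 (schedule A s f x n).1).1
            cfg_zero := rfl
            enabled := fun n => enabled_guarded _ _ _
            cfg_succ := fun n => rfl
            unique_writes := ?_ }, fun n => (schedule A s f x n).2, hsingle, rfl,
            fun n => ⟨rfl, rfl⟩⟩
  intro k c T y k' c' T' y' v h1 h2 h3 h4
  rcases hsingle _ _ _ h1 with h | ⟨rfl, rfl⟩
  · rw [h y] at h2; cases h2
  rcases hsingle _ _ _ h3 with h | ⟨rfl, rfl⟩
  · rw [h y'] at h4; cases h4
  exact ⟨rfl, hTw _ _ _ h2 h4⟩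

open Execution in
/-- The first `N` steps of an execution can be continued by any scheduler. -/
theorem exists_branch (s : Server) {Tw : Txn Obj Val}
    (hTw : ∀ x x' v, Tw.writes x = some v → Tw.writes x' = some v → x = x')
    {E : A.Execution} (hE : SingleWrite Tw E) (N : ℕ)
    (F : ℕ → Config Obj Val Client Server Msg SState CState → Action Obj Val Client Server)
    (hF : ∀ t g c T, F t g = .start c T → T.ReadOnly) :
    ∃ E' : A.Execution, SingleWrite Tw E' ∧ AgreeTo N E E' ∧
      ∀ t, N ≤ t → E'.act t = guarded s (E'.cfg t) (F t (E'.cfg t)) := by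
  obtain ⟨E', _, h1, _, h2⟩ := exists_execution (A := A) s hTw
    (fun t (u : Unit) g => (if t < N then E.act t else F t g, u)) () (by
      intro n y g c T h
      dsimp only at h
      split_ifs at h with hn
      · exact hE _ _ _ h
      · exact Or.inl (hF _ _ _ _ h))
  refine ⟨E', h1, ?_, fun t ht => ?_⟩
  -- Below `N` the actions are replayed; as the configurations agree inductively, each replayed
  -- action is still enabled and the guard does not alter it.
  · intro i
    induction i using Nat.strong_induction_on with
    | _ i ih =>
      intro hi
      have hc : E'.cfg i = E.cfg i :=
        AgreeTo.cfg (n := i) (fun j hj => ih j hj (by omega)) le_rfl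
      rw [(h2 i).1]
      simp only [hi, if_true, hc]
      exact guarded_of_enabled (E.enabled i)
  · rw [(h2 t).1]
    simp [not_lt.2 ht]

open Execution in
theorem exists_extend (s : Server) {Tw : Txn Obj Val}
    (hTw : ∀ x x' v, Tw.writes x = some v → Tw.writes x' = some v → x = x')
    {E : A.Execution} (hE : SingleWrite Tw E) (N : ℕ) (a : Action Obj Val Client Server)
    (ha : Enabled (E.cfg N) a) (hF : ∀ c T, a = .start c T → T.ReadOnly) :
    ∃ E' : A.Execution, SingleWrite Tw E' ∧ AgreeTo N E E' ∧ E'.act N = a := by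
  obtain ⟨E', h1, h2, h3⟩ := exists_branch s hTw hE N (fun _ _ => a) fun _ _ => hF
  refine ⟨E', h1, h2, ?_⟩
  rw [h3 N le_rfl, h2.cfg le_rfl]
  exact guarded_of_enabled ha

/-! ### Solo behaviour of a client and possible answers of a server -/

/-- The result of the last step of client `c` when it starts its first transaction `T` and then
takes `k` local steps. -/
def clientSolo (A : Protocol Obj Val Client Server Msg SState CState) (c : Client)
    (T : Txn Obj Val) : ℕ → CState × List (Server × Msg) × Option (Obj → Option Val)
  | 0 => A.clientStep c (A.clientInit c) (.start T)
  | k + 1 => A.clientStep c (clientSolo A c T k).1 .tick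

/-- The state of server `s` after `k` local steps. -/
def serverSolo (A : Protocol Obj Val Client Server Msg SState CState) (s : Server) (x : SState)
    (k : ℕ) : SState :=
  (fun y => (A.serverStep s y none).1)^[k] x

/-- The messages which server `s` sends in the `j`-th step from the reception of `b` on. -/
def serverAnswer (A : Protocol Obj Val Client Server Msg SState CState) (s : Server) (x : SState)
    (c : Client) (b : Msg) : ℕ → List ((Client ⊕ Server) × Msg)
  | 0 => (A.serverStep s x (some (Sum.inl c, b))).2
  | j + 1 => (A.serverStep s
      (serverSolo A s (A.serverStep s x (some (Sum.inl c, b))).1 j) none).2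

/-- Server `s`, starting in state `x` and receiving only what the fresh client `c` sends to it for
transaction `T` by itself, may send `m` to `c`. -/
def Reply (A : Protocol Obj Val Client Server Msg SState CState) (c : Client) (T : Txn Obj Val)
    (s : Server) (x : SState) (m : Msg) : Prop :=
  ∃ k b a j, (s, b) ∈ (clientSolo A c T k).2.1 ∧
    (Sum.inl c, m) ∈ serverAnswer A s (serverSolo A s x a) c b j

theorem serverSolo_succ (s : Server) (x : SState) (k : ℕ) :
    serverSolo A s x (k + 1) = (A.serverStep s (serverSolo A s x k) none).1 :=
  Function.iterate_succ_apply' _ _ _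

theorem filterMap_eq_singleton {α β : Type*} {f : α → Option β} {l : List α} (hl : l.Nodup)
    {a : α} (ha : a ∈ l) {b : β} (hb : f a = some b) (h : ∀ a' ∈ l, f a' ≠ none → a' = a) :
    l.filterMap f = [b] := by
  induction l with
  | nil => cases ha
  | cons d l ih =>
    rw [List.nodup_cons] at hl
    rcases List.mem_cons.1 ha with rfl | ha'
    · rw [List.filterMap_cons_some hb, List.filterMap_eq_nil_iff.2]
      intro d hd
      by_contra hne
      exact hl.1 (h d (List.mem_cons_of_mem _ hd) hne ▸ hd)
    · rw [List.filterMap_cons_none, ih hl.2 ha' fun a' h' => h a' (List.mem_cons_of_mem _ h')]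
      by_contra hne
      have := h d List.mem_cons_self hne
      exact hl.1 (this ▸ ha')

namespace Execution

variable {E : A.Execution}

theorem exists_receives_of_inbox_ne_nil {c : Client} {s : Server} {n m : ℕ}
    (h : E.inbox c s n m ≠ []) :
    ∃ t i msg, n ≤ t ∧ t ≤ m ∧ E.Receives t i (Sum.inr s) (Sum.inl c) msg := by
  classical
  contrapose! h
  unfold inbox
  rw [List.filterMap_eq_nil_iff]
  intro t ht
  rw [List.mem_range'_1] at ht
  split
  · rename_i i hi
    split
    · rename_i s' c' msg hmsg
      rw [if_neg]
      rintro ⟨rfl, rfl⟩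
      exact h t i msg ht.1 (by omega) ⟨hi, hmsg⟩
    · rfl
  · rfl

theorem inbox_eq_singleton {c : Client} {s : Server} {n m t i : ℕ} {msg : Msg} (hn : n ≤ t)
    (hm : t ≤ m) (ht : E.Receives t i (Sum.inr s) (Sum.inl c) msg)
    (h : ∀ t' i' msg', n ≤ t' → t' ≤ m → E.Receives t' i' (Sum.inr s) (Sum.inl c) msg' → i' = i) :
    E.inbox c s n m = [msg] := by
  classical
  unfold inbox
  refine filterMap_eq_singleton (a := t) List.nodup_range' ?_ ?_ ?_
  · rw [List.mem_range'_1]; omega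
  · simp only [ht.1, ht.2]; simp
  · intro t' ht' hne
    rw [List.mem_range'_1] at ht'
    by_contra hne'
    apply hne
    split
    · rename_i i' hi
      split
      · rename_i s' c' msg' hmsg
        rw [if_neg]
        rintro ⟨rfl, rfl⟩
        obtain rfl := h t' i' msg' ht'.1 (by omega) ⟨hi, hmsg⟩
        exact hne' (E.deliver_unique hi ht.1)
      · rfl
    · rfl

/-- A server that receives nothing can only take local steps; how many is left open, which is why
`Reply` quantifies over their number. -/
theorem server_trace {a b : ℕ} {s : Server} (hab : a ≤ b)
    (h : ∀ t i p m, a ≤ t → t < b → ¬ E.Receives t i p (Sum.inr s) m) :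
    ∃ j, (E.cfg b).serverState s = serverSolo A s ((E.cfg a).serverState s) j := by
  induction b, hab using Nat.le_induction with
  | base => exact ⟨0, rfl⟩
  | succ b hab ih =>
    obtain ⟨j, hj⟩ := ih fun t i p m h1 h2 => h t i p m h1 (by omega)
    by_cases h' : ∀ inp, serverInput (E.cfg b) (E.act b) ≠ some (s, inp)
    · exact ⟨j, by rw [E.cfg_succ, next_serverState_of_none _ h', hj]⟩
    push Not at h'
    obtain ⟨_ | ⟨p, m⟩, hinp⟩ := h'
    · exact ⟨j + 1, by rw [E.cfg_succ, (next_serverState _ hinp).1, hj, serverSolo_succ]⟩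
    · obtain ⟨i, hi⟩ := E.serverInput_some hinp
      exact absurd hi (h _ _ _ _ hab (by omega))

theorem client_trace (hrespond : A.ServersOnlyRespond) {n t : ℕ} {c : Client} {T : Txn Obj Val}
    (hf : E.Fresh n c) (hs : E.Starts n c T) (hnt : n < t)
    (hrun : ∀ k, n < k → k < t → (E.cfg k).active c ≠ none)
    (h : ∀ u i s m, n ≤ u → u < t → ¬ E.Receives u i (Sum.inr s) (Sum.inl c) m) :
    ∃ k, (E.cfg t).clientState c = (clientSolo A c T k).1 := by
  induction t, hnt using Nat.le_induction with
  | base =>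
    refine ⟨0, ?_⟩
    rw [E.cfg_succ, next_clientState (inp := .start T), hf.clientState hrespond]
    · rfl
    · rw [hs]; rfl
  | succ t hnt ih =>
    obtain ⟨k, hk⟩ := ih (fun k h1 h2 => hrun k h1 (by omega))
      fun u i s m h1 h2 => h u i s m h1 (by omega)
    by_cases h' : ∀ inp, clientInput (E.cfg t) (E.act t) ≠ some (c, inp)
    · exact ⟨k, by rw [E.cfg_succ, (next_clientState_of_none _ h').1, hk]⟩
    push Not at h'
    obtain ⟨T' | ⟨s, m⟩ | _, hinp⟩ := h'
    · have := E.enabled t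
      rw [E.clientInput_start hinp] at this
      exact absurd this (hrun t hnt (by omega))
    · obtain ⟨i, hi⟩ := E.clientInput_recv hinp
      exact absurd hi (h _ _ _ _ (by omega) (by omega))
    · exact ⟨k + 1, by rw [E.cfg_succ, next_clientState _ hinp, hk]; rfl⟩

/-- Up to its first reception the client only starts `T` and ticks, whatever the servers do, so its
requests can be reproduced in any other execution in which it is fresh. -/
theorem client_sends (hrespond : A.ServersOnlyRespond) {n t i : ℕ} {c : Client} {T : Txn Obj Val}
    {s : Server} {b : Msg} (hf : E.Fresh n c) (hs : E.Starts n c T) (hrun : E.Running n c t)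
    (h : ∀ u i s m, n ≤ u → u ≤ t → ¬ E.Receives u i (Sum.inr s) (Sum.inl c) m)
    (hsend : E.Sends t i (Sum.inl c) (Sum.inr s) b) :
    ∃ k, (s, b) ∈ (clientSolo A c T k).2.1 := by
  rcases hsend.mem with ⟨s, inp, h1, h2, h3⟩ | ⟨c', inp, s', h1, h2, h3, h4, h5⟩
  · cases h2
  cases h2; cases h3
  rcases hrun.1.eq_or_lt with rfl | hlt
  · refine ⟨0, ?_⟩
    rw [hs] at h1
    cases h1
    rwa [hf.clientState hrespond] at h4
  · obtain ⟨k, hk⟩ := client_trace hrespond hf hs hlt (fun k h1 h2 => hrun.2 k h1 h2.le)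
      fun u i s m h1 h2 => h u i s m h1 h2.le
    rw [hk] at h4
    rcases inp with T' | ⟨s, m⟩ | _
    · have := E.enabled t
      rw [E.clientInput_start h1] at this
      exact absurd this (hrun.2 t hlt le_rfl)
    · obtain ⟨i, hi⟩ := E.clientInput_recv h1
      exact absurd hi (h _ _ _ _ hrun.1 le_rfl)
    · exact ⟨k + 1, h4⟩

theorem Fresh.length_le_of_receives_by (hrespond : A.ServersOnlyRespond) {n t i : ℕ} {c : Client}
    {p : Client ⊕ Server} {m : Msg} (hf : E.Fresh n c) (hn : n ≤ t)
    (h : E.Receives t i p (Sum.inl c) m) : (E.cfg n).sent.length ≤ i := by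
  by_contra hlt
  exact hf.not_sent_to hrespond (E.sent_back hn h.2 (by omega))

/-- An invocation by a fresh client during which servers receive messages from this client only
returns values which are revealed by answers to what the client sends by itself. -/
theorem ends_with_replies {stores : Server → Set Obj}
    {reveal : Client → CState → Txn Obj Val → Server → List Msg → Obj → Option (Option Val)}
    (hrespond : A.ServersOnlyRespond)
    (hnil : ∀ c σ T s x, reveal c σ T s [] x = none)
    (hone : ∀ (E : A.Execution) n c T m ρ, E.Starts n c T → E.Ends n c m ρ → ∀ x ∈ T.reads,
      (∃ s, x ∈ stores s ∧
        reveal c ((E.cfg n).clientState c) T s (E.inbox c s n m) x = some (ρ x)) ∧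
      (∀ s v, x ∈ stores s →
        reveal c ((E.cfg n).clientState c) T s (E.inbox c s n m) x = some v → v = ρ x))
    {n : ℕ} {c : Client} {T : Txn Obj Val} (hfast : A.Fast T)
    (hf : E.Fresh n c) (hs : E.Starts n c T) (hfair : E.FairTo c)
    (hiso : ∀ t i p s m, E.Running n c t → E.Receives t i p (Sum.inr s) m → p = Sum.inl c) :
    ∃ m ρ, E.Ends n c m ρ ∧ ∀ x ∈ T.reads, ∃ s msg, x ∈ stores s ∧
      Reply A c T s ((E.cfg n).serverState s) msg ∧
      reveal c (A.clientInit c) T s [msg] x = some (ρ x) := by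
  -- Isolation is vacuous: by `hiso` no server receives a message from a server during the
  -- invocation.
  have hisol : E.Isolated n c := fun t i s s' m hr hrec => by
    have := hiso _ _ _ _ _ hr hrec
    cases this
  obtain ⟨⟨m, ρ, hends⟩, h1, h2, h3⟩ := hfast E n c hs hfair hisol
  refine ⟨m, ρ, hends, fun x hx => ?_⟩
  obtain ⟨⟨s, hxs, hrev⟩, -⟩ := hone E n c T m ρ hs hends x hx
  have hne : E.inbox c s n m ≠ [] := by
    intro h
    rw [h, hnil] at hrev
    cases hrev
  have hrun : ∀ t, n ≤ t → t ≤ m → E.Running n c t := fun t => hends.1.mono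
  obtain ⟨t, i, msg, hnt, htm, hrec⟩ := exists_receives_of_inbox_ne_nil hne
  have hi := hf.length_le_of_receives_by hrespond hnt hrec
  have hbox : E.inbox c s n m = [msg] := by
    refine inbox_eq_singleton hnt htm hrec fun t' i' msg' h4 h5 h6 => ?_
    exact h2 s t' t i' i msg' msg (hrun _ h4 h5) (hrun _ hnt htm)
      (hf.length_le_of_receives_by hrespond h4 h6) hi h6 hrec
  rw [hbox, hf.clientState hrespond] at hrev
  refine ⟨s, msg, hxs, ?_, hrev⟩
  -- The answer is traced back: it was sent at `ts`, and its sender had received some `b` from `c`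
  -- before, at `t'`.
  obtain ⟨ts, hnts, htst, hsend⟩ := E.exists_sends hnt hi hrec.2
  obtain ⟨t', i', b, ht's, hrec'⟩ := hrespond E ts i s c msg hsend
  -- everything which a server receives from `c` was sent in this invocation
  have hsent : ∀ u j d, u ≤ ts → E.Receives u j (Sum.inl c) (Sum.inr s) d →
      n < u ∧ ∃ v, n ≤ v ∧ v < u ∧ E.Sends v j (Sum.inl c) (Sum.inr s) d := by
    intro u j d _ hu
    have hnu : n < u := by
      by_contra hle
      exact hf.not_sent_by (E.sent_stable (not_lt.1 hle) hu.2)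
    refine ⟨hnu, E.exists_sends hnu.le ?_ hu.2⟩
    by_contra hlt
    exact hf.not_sent_by (E.sent_back hnu.le hu.2 (not_le.1 hlt))
  obtain ⟨hnt', tb, hntb, htbt', hsendb⟩ := hsent t' i' b ht's hrec'
  -- By the last clause of `OneRound`, `c` had received nothing when it sent `b`, so `b` belongs to
  -- the solo run.
  obtain ⟨k, hk⟩ := client_sends hrespond hf hs (hrun tb hntb (by omega))
    (fun u j s' d h4 h5 h6 => h3 s' s u tb j i' d b (hrun u h4 (by omega)) (hrun tb hntb (by omega))
      h5 (hf.length_le_of_receives_by hrespond h4 h6) h6 hsendb) hsendb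
  -- The server hears from `c` only, and `c` sends it only one message; so its steps are local ones,
  -- the reception of `b`, and local ones again.
  have honly : ∀ u j p d, n ≤ u → u ≤ ts → E.Receives u j p (Sum.inr s) d → u = t' := by
    intro u j p d h4 h5 h6
    obtain rfl := hiso _ _ _ _ _ (hrun u h4 (by omega)) h6
    obtain ⟨h7, v, h8, h9, h10⟩ := hsent u j d h5 h6
    obtain rfl := h1 s v tb j i' d b (hrun _ h8 (by omega)) (hrun _ hntb (by omega)) h10 hsendb
    exact E.deliver_unique h6.1 hrec'.1
  obtain ⟨a, ha⟩ := server_trace (E := E) (s := s) hnt'.le fun u j p d h4 h5 h6 => by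
    have := honly u j p d h4 (by omega) h6
    omega
  have hinp := hrec'.serverInput
  refine ⟨k, b, a, ?_⟩
  rw [← ha]
  rcases hsend.mem with ⟨s', inp, h4, h5, h6⟩ | ⟨c', inp, s', h4, h5, -⟩
  swap
  · cases h5
  cases h5
  rcases ht's.eq_or_lt with rfl | hlt
  · rw [hinp] at h4
    cases h4
    exact ⟨0, hk, h6⟩
  · obtain ⟨j, hj⟩ := server_trace (E := E) (s := s) (a := t' + 1) (b := ts) hlt
      fun u j p d h4 h5 h6 => by
        have := honly u j p d (by omega) (by omega) h6
        omega
    rcases inp with _ | ⟨p, d⟩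
    · refine ⟨j + 1, hk, ?_⟩
      rw [E.cfg_succ, (next_serverState _ hinp).1] at hj
      rwa [hj] at h6
    · obtain ⟨j, hj⟩ := E.serverInput_some h4
      have := honly _ _ _ _ hnts le_rfl hj
      omega

end Execution

/-! ### Schedules that serve a single client -/

/-- The scheduling decision which corresponds to a task: receive a message, or let a server or the
client `c` take a local step. -/
def taskAction (c : Client) : ℕ ⊕ Server ⊕ Unit → Action Obj Val Client Server
  | .inl i => .deliver i
  | .inr (.inl s) => .serverTick s
  | .inr (.inr _) => .clientTick c

/-- An action which does not start a transaction, and receives only messages between client `c` and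
the servers. -/
def LocalTo (c : Client) (g : Config Obj Val Client Server Msg SState CState) :
    Action Obj Val Client Server → Prop
  | .start _ _ => False
  | .deliver i => ∃ s m, g.sent[i]? = some ⟨Sum.inl c, Sum.inr s, m⟩ ∨
      g.sent[i]? = some ⟨Sum.inr s, Sum.inl c, m⟩
  | .clientTick _ => True
  | .serverTick _ => True

open Classical in
/-- The scheduling decision given by a task, as far as it concerns client `c` only. -/
noncomputable def localAction (s : Server) (c : Client) (u : ℕ ⊕ Server ⊕ Unit)
    (g : Config Obj Val Client Server Msg SState CState) : Action Obj Val Client Server :=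
  if LocalTo c g (taskAction c u) then taskAction c u else .serverTick s

theorem localTo_localAction (s : Server) (c : Client) (u : ℕ ⊕ Server ⊕ Unit)
    (g : Config Obj Val Client Server Msg SState CState) :
    LocalTo c g (guarded s g (localAction s c u g)) := by
  rcases guarded_cases s g (localAction s c u g) with h | h <;> rw [h]
  · unfold localAction
    split_ifs with h'
    · exact h'
    · trivial
  · trivial

theorem localAction_ne_start (s : Server) (c : Client) (u : ℕ ⊕ Server ⊕ Unit)
    (g : Config Obj Val Client Server Msg SState CState) (c' : Client) (T : Txn Obj Val) :
    localAction s c u g ≠ .start c' T := by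
  intro h
  unfold localAction at h
  split_ifs at h with h'
  rw [h] at h'
  exact h'

/-- The first component of the pairing function takes each of its values infinitely often. The
sequence lets a scheduler perform every task at arbitrarily late times. -/
theorem exists_recurrent (α : Type*) [Countable α] [Nonempty α] :
    ∃ e : ℕ → α, ∀ x N, ∃ n, N ≤ n ∧ e n = x := by
  obtain ⟨f, hf⟩ := exists_surjective_nat α
  refine ⟨fun n => f n.unpair.1, fun x N => ?_⟩
  obtain ⟨a, rfl⟩ := hf x
  exact ⟨Nat.pair a N, Nat.right_le_pair _ _, by simp⟩

-- It suffices that the tasks of `c` are scheduled from some step on: every task recurs, and a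
-- message found to be already received at its turn needs no further step.
open Execution in
theorem fairTo_of_local {E : A.Execution} {s₀ : Server} {c : Client} {N : ℕ}
    {e : ℕ → ℕ ⊕ Server ⊕ Unit} (he : ∀ x N, ∃ n, N ≤ n ∧ e n = x)
    (h : ∀ t, N ≤ t → E.act t = guarded s₀ (E.cfg t) (localAction s₀ c (e t) (E.cfg t))) :
    E.FairTo c := by
  refine ⟨fun n i s m hi => ?_, fun s n => ?_, fun n => ?_⟩
  · obtain ⟨t, ht, het⟩ := he (.inl i) (max n N)
    have hi' : (E.cfg t).sent[i]? = some ⟨Sum.inl c, Sum.inr s, m⟩ ∨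
        (E.cfg t).sent[i]? = some ⟨Sum.inr s, Sum.inl c, m⟩ :=
      hi.imp (E.sent_stable (by omega)) (E.sent_stable (by omega))
    by_cases hr : i ∈ (E.cfg t).received
    · obtain ⟨t', -, ht'⟩ := E.exists_deliver_of_received hr
      exact ⟨t', ht'⟩
    · refine ⟨t, ?_⟩
      have hen : Enabled (E.cfg t) (.deliver i : Action Obj Val Client Server) :=
        ⟨hi'.elim (fun h => (List.getElem?_eq_some_iff.1 h).1)
          fun h => (List.getElem?_eq_some_iff.1 h).1, hr⟩
      have hl : LocalTo c (E.cfg t) (taskAction c (.inl i : ℕ ⊕ Server ⊕ Unit)) := ⟨s, m, hi'⟩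
      rw [h t (by omega), het, localAction, if_pos hl]
      exact guarded_of_enabled hen
  · obtain ⟨t, ht, het⟩ := he (.inr (.inl s)) (max n N)
    refine ⟨t, by omega, ?_⟩
    rw [h t (by omega), het, localAction, if_pos (by trivial)]
    exact guarded_of_enabled trivial
  · obtain ⟨t, ht, het⟩ := he (.inr (.inr ())) (max n N)
    refine ⟨t, by omega, ?_⟩
    by_cases hact : (E.cfg t).active c = none
    · exact Or.inr hact
    · left
      rw [h t (by omega), het, localAction, if_pos (by trivial)]
      exact guarded_of_enabled hact

open Execution in
theorem receives_of_local {E : A.Execution} {c : Client} {t i : ℕ} {p : Client ⊕ Server}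
    {s : Server} {m : Msg} (h : LocalTo c (E.cfg t) (E.act t))
    (hr : E.Receives t i p (Sum.inr s) m) : p = Sum.inl c := by
  rw [hr.1] at h
  obtain ⟨s', m', h | h⟩ := h
  · rw [hr.2] at h; cases h; rfl
  · rw [hr.2] at h; cases h

theorem next_client (g : Config Obj Val Client Server Msg SState CState)
    {a : Action Obj Val Client Server} {c : Client}
    {inp : ClientInput Obj Val Server Msg} (h : clientInput g a = some (c, inp))
    (hact : (∃ T, inp = .start T) ∨ g.active c ≠ none) :
    (A.next g a).sent = g.sent ++ (A.clientStep c (g.clientState c) inp).2.1.map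
      (fun p => ⟨Sum.inl c, Sum.inr p.1, p.2⟩) ∧
    ((A.clientStep c (g.clientState c) inp).2.2 = none → (A.next g a).active c ≠ none) := by
  rcases next_cases (A := A) g a with
    ⟨s', inp', g', h1, h2, h3, h4, h5, h6, h7⟩ | ⟨c', inp', g', h1, h2, h3, h4, h5, h6, h7, h8, h9⟩ |
    ⟨h1, h2, h3, h4, h5, h6⟩
  · rw [h2] at h; cases h
  · rw [h2] at h; cases h
    have hg : g'.active c ≠ none := by
      by_cases hT : ∃ T, inp = .start T
      · obtain ⟨T, hT⟩ := hT
        rw [(h8 T hT).2]; simp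
      · have hT' : ∀ T, inp ≠ .start T := fun T h => hT ⟨T, h⟩
        rw [h7 hT']
        exact hact.resolve_left hT
    refine ⟨by rw [h3, clientMove_sent_of_active _ _ hg, h5, h9], fun hr => ?_⟩
    rw [h3, clientMove_active_self _ (by rwa [h5])]
    exact hg
  · rw [h2] at h; cases h

namespace Execution

/-- A message sent in step `t` has an index beyond all messages sent before, and a reception, in
step `t` or earlier, is enabled only for indices below that bound. -/
theorem Sends.pending {E : A.Execution} {t i : ℕ} {p q : Client ⊕ Server} {m : Msg}
    (h : E.Sends t i p q m) : Pending (E.cfg (t + 1)) i p q m := by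
  refine ⟨h.2, fun hr => ?_⟩
  rw [E.cfg_succ] at hr
  rcases next_received_subset _ _ hr with hr | hr
  · exact absurd (E.lt_length_of_received hr) (not_lt.2 h.1)
  · have := E.enabled t
    rw [hr] at this
    exact absurd this.1 (not_lt.2 h.1)

theorem exists_sends_of_mem {E : A.Execution} {t : ℕ} {l : List (Envelope Client Server Msg)}
    (h : (E.cfg (t + 1)).sent = (E.cfg t).sent ++ l) {p q : Client ⊕ Server} {m : Msg}
    (hm : (⟨p, q, m⟩ : Envelope Client Server Msg) ∈ l) : ∃ i, E.Sends t i p q m := by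
  obtain ⟨j, hj, hj'⟩ := List.getElem_of_mem hm
  refine ⟨(E.cfg t).sent.length + j, by omega, ?_⟩
  rw [h, List.getElem?_append_right (by omega)]
  simp [hj, hj']

end Execution

/-! ### Reads by a fresh client -/

/-- The properties of a storage with fast read-only transactions that matter for the transactions
`T`, which reads all objects, and `Tw`, which writes all objects. -/
structure FastStorage (A : Protocol Obj Val Client Server Msg SState CState)
    (stores : Server → Set Obj)
    (reveal : Client → CState → Txn Obj Val → Server → List Msg → Obj → Option (Option Val))
    (T Tw : Txn Obj Val) : Prop where
  noFull : ∀ s, ∃ x, x ∉ stores s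
  respond : A.ServersOnlyRespond
  reveal_nil : ∀ c σ T s x, reveal c σ T s [] x = none
  reveal_eq : ∀ (E : A.Execution) n c T m ρ, E.Starts n c T → E.Ends n c m ρ → ∀ x ∈ T.reads,
      (∃ s, x ∈ stores s ∧
        reveal c ((E.cfg n).clientState c) T s (E.inbox c s n m) x = some (ρ x)) ∧
      (∀ s v, x ∈ stores s →
        reveal c ((E.cfg n).clientState c) T s (E.inbox c s n m) x = some v → v = ρ x)
  causal : A.CausallyConsistent
  fast : A.Fast T
  readOnly : T.ReadOnly
  reads : ∀ x, x ∈ T.reads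
  writes : ∀ x, ∃ v, Tw.writes x = some v
  injective : ∀ x x' v, Tw.writes x = some v → Tw.writes x' = some v → x = x'

namespace FastStorage

open Execution

variable {stores : Server → Set Obj}
  {reveal : Client → CState → Txn Obj Val → Server → List Msg → Obj → Option (Option Val)}
  {T Tw : Txn Obj Val}

/-- This is the use of causal consistency: a value that is read comes from `Tw`, which is then
ordered before the read, and this excludes `⊥` for every object because `Tw` writes them all. -/
theorem exists_write (H : FastStorage A stores reveal T Tw) {E : A.Execution}
    (hE : SingleWrite Tw E) {n m : ℕ} {c : Client} {ρ : Obj → Option Val} (hs : E.Starts n c T)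
    (hends : E.Ends n c m ρ) {y : Obj} {v : Val} (hy : ρ y = some v) :
    (∃ c', E.Starts 0 c' Tw) ∧ ∀ x, ρ x ≠ none := by
  obtain ⟨pos, -, h1, h2, -⟩ := H.causal E (m + 1) c
  have hread : ∀ z, E.IsOp (m + 1) ⟨n, .read, z, ρ z⟩ := fun z =>
    ⟨c, T, m, ρ, hs, hends, Nat.lt_succ_self m, H.reads z, rfl⟩
  have hord : E.Ordered (m + 1) c n :=
    ⟨Nat.lt_succ_of_le hends.1.1, c, T, hs, Or.inl rfl⟩
  obtain ⟨⟨k, wk, wx, wv⟩, hw, hkind, -, -, hlt, -⟩ := h1 _ v (hread y) rfl hord hy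
  dsimp only at hkind hlt
  subst hkind
  obtain ⟨hlt', c', T', v', hs', hv', -⟩ := hw
  dsimp only at hs' hv' hlt'
  rcases hE _ _ _ hs' with hro | ⟨rfl, rfl⟩
  · rw [hro] at hv'; cases hv'
  refine ⟨⟨c', hs'⟩, fun x hx => ?_⟩
  obtain ⟨u, hu⟩ := H.writes x
  -- `pos` ranks transactions rather than operations, so the bound found for the write of `y`
  -- applies to the write of `x`.
  exact h2 _ (hread x) rfl hord hx ⟨0, .write, x, some u⟩ ⟨hlt', c', _, u, hs', hu, rfl⟩ rfl rfl hlt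

/-- From any point at which `c` is fresh, `c` can read in isolation. -/
theorem exists_local_read [Finite Server] (H : FastStorage A stores reveal T Tw) (s₀ : Server)
    {E : A.Execution} (hE : SingleWrite Tw E) {n : ℕ} {c : Client} (hf : E.Fresh n c) :
    ∃ E' : A.Execution, SingleWrite Tw E' ∧ AgreeTo n E E' ∧ E'.Starts n c T ∧
      ∃ m ρ, E'.Ends n c m ρ ∧ ∀ x, ∃ s msg, x ∈ stores s ∧
        Reply A c T s ((E.cfg n).serverState s) msg ∧
        reveal c (A.clientInit c) T s [msg] x = some (ρ x) := by
  obtain ⟨e, he⟩ := exists_recurrent (ℕ ⊕ Server ⊕ Unit)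
  obtain ⟨E₁, hE₁, hag₁, hs₁⟩ := exists_extend s₀ H.injective hE n (.start c T) hf.active
    fun c' T' h => by cases h; exact H.readOnly
  obtain ⟨E', hE', hag, hloc⟩ := exists_branch s₀ H.injective hE₁ (n + 1)
    (fun t g => localAction s₀ c (e t) g)
    fun t g c' T' h => absurd h (localAction_ne_start _ _ _ _ _ _)
  have hs : E'.Starts n c T := (hag n (by omega)).trans hs₁
  have hag' : AgreeTo n E E' := hag₁.trans hag (by omega)
  refine ⟨E', hE', hag', hs, ?_⟩
  have := ends_with_replies (E := E') H.respond H.reveal_nil H.reveal_eq H.fast (hag'.fresh hf) hs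
    (fairTo_of_local he hloc) fun t i p s m hr hrec => by
      rcases hr.1.eq_or_lt with rfl | hlt
      · have := hs.symm.trans hrec.1
        cases this
      · refine receives_of_local ?_ hrec
        rw [hloc t hlt]
        exact localTo_localAction _ _ _ _
  obtain ⟨m, ρ, h1, h2⟩ := this
  rw [hag'.cfg le_rfl] at h2
  exact ⟨m, ρ, h1, fun x => h2 x (H.reads x)⟩

/-- A fresh client can take `k` local steps after it has started `T`. -/
theorem exists_solo (H : FastStorage A stores reveal T Tw) (s₀ : Server)
    {E : A.Execution} (hE : SingleWrite Tw E) {n : ℕ} {c : Client} (hf : E.Fresh n c) (k : ℕ)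
    (hk : ∀ j, j ≤ k → (clientSolo A c T j).2.2 = none) :
    ∃ E' : A.Execution, SingleWrite Tw E' ∧ AgreeTo n E E' ∧ E'.Starts n c T ∧
      (E'.cfg (n + k + 1)).clientState c = (clientSolo A c T k).1 ∧
      (∀ s, (E'.cfg (n + k + 1)).serverState s = (E.cfg n).serverState s) ∧
      E'.Running n c (n + k + 1) ∧
      (∀ t i p q m, n ≤ t → t < n + k + 1 → ¬ E'.Receives t i p q m) ∧
      ∀ j s b, j ≤ k → (s, b) ∈ (clientSolo A c T j).2.1 →
        ∃ i, Pending (E'.cfg (n + k + 1)) i (Sum.inl c) (Sum.inr s) b := by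
  induction k with
  | zero =>
    obtain ⟨E', hE', hag, hs⟩ := exists_extend s₀ H.injective hE n (.start c T) hf.active
      fun c' T' h => by cases h; exact H.readOnly
    have hf' := hag.fresh hf
    have hinp : clientInput (E'.cfg n) (E'.act n) = some (c, .start T) := by rw [hs]; rfl
    have hnext := next_client (A := A) _ hinp (Or.inl ⟨T, rfl⟩)
    rw [← E'.cfg_succ, hf'.clientState H.respond] at hnext
    refine ⟨E', hE', hag, hs, ?_, fun s => ?_, ⟨by omega, fun k h1 h2 => ?_⟩, ?_, ?_⟩
    · rw [add_zero, E'.cfg_succ, next_clientState _ hinp, hf'.clientState H.respond]; rfl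
    · rw [add_zero, E'.cfg_succ, next_serverState_of_none, hag.cfg le_rfl]
      rw [hs]; simp [serverInput]
    · obtain rfl : k = n + 1 := by omega
      exact hnext.2 (hk 0 le_rfl)
    · intro t i p q m h1 h2 hr
      obtain rfl : t = n := by omega
      have := hs.symm.trans hr.1
      cases this
    · intro j s b hj hb
      obtain rfl : j = 0 := by omega
      obtain ⟨i, hi⟩ := exists_sends_of_mem hnext.1 (List.mem_map_of_mem hb)
      exact ⟨i, hi.pending⟩
  | succ k ih =>
    obtain ⟨E₁, hE₁, hag₁, hs₁, hst, hsv, hrun, hrec, hpend⟩ := ih fun j hj => hk j (by omega)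
    obtain ⟨E', hE', hag, ha⟩ := exists_extend s₀ H.injective hE₁ (n + k + 1) (.clientTick c)
      (hrun.2 _ (by omega) le_rfl) fun c' T' h => by cases h
    have hcfg := hag.cfg le_rfl
    have hinp : clientInput (E'.cfg (n + k + 1)) (E'.act (n + k + 1)) = some (c, .tick) := by
      rw [ha]; rfl
    have hact : (E'.cfg (n + k + 1)).active c ≠ none := by
      rw [hcfg]; exact hrun.2 _ (by omega) le_rfl
    have hnext := next_client (A := A) _ hinp (Or.inr hact)
    rw [← E'.cfg_succ, hcfg, hst] at hnext
    refine ⟨E', hE', hag₁.trans hag (by omega), (hag n (by omega)).trans hs₁, ?_, fun s => ?_,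
      ⟨by omega, fun k' h1 h2 => ?_⟩, ?_, ?_⟩
    · rw [← add_assoc, E'.cfg_succ, next_clientState _ hinp, hcfg, hst]; rfl
    · rw [← add_assoc, E'.cfg_succ, next_serverState_of_none, hcfg, hsv]
      rw [ha]; simp [serverInput]
    · rcases Nat.lt_or_ge k' (n + k + 2) with h | h
      · rw [hag.cfg (by omega)]
        exact hrun.2 _ h1 (by omega)
      · obtain rfl : k' = n + k + 1 + 1 := by omega
        exact hnext.2 (hk (k + 1) le_rfl)
    · intro t i p q m h1 h2 hr
      rcases Nat.lt_or_ge t (n + k + 1) with h | h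
      · exact hrec t i p q m h1 h ((hag.receives h).1 hr)
      · obtain rfl : t = n + k + 1 := by omega
        have := ha.symm.trans hr.1
        cases this
    · intro j s b hj hb
      rcases Nat.lt_or_ge j (k + 1) with h | h
      · obtain ⟨i, hi⟩ := hpend j s b (by omega) hb
        refine ⟨i, ?_⟩
        rw [← add_assoc, E'.cfg_succ]
        rw [← hcfg] at hi
        exact pending_next _ hi (by rw [ha]; simp)
      · obtain rfl : j = k + 1 := by omega
        have hsent := hnext.1
        rw [← hcfg] at hsent
        obtain ⟨i, hi⟩ := exists_sends_of_mem hsent (List.mem_map_of_mem hb)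
        exact ⟨i, hi.pending⟩

/-- A client does not return before it has received a message. -/
theorem clientSolo_not_return [Nonempty Obj] (H : FastStorage A stores reveal T Tw) (s₀ : Server)
    {E : A.Execution} (hE : SingleWrite Tw E) {n : ℕ} {c : Client} (hf : E.Fresh n c) (k : ℕ) :
    (clientSolo A c T k).2.2 = none := by
  induction k using Nat.strong_induction_on with
  | _ k ih =>
  by_contra hne
  obtain ⟨ρ, hρ⟩ := Option.ne_none_iff_exists'.1 hne
  -- An invocation that ends without any reception has empty inboxes, which reveal nothing, although
  -- some server has to reveal each value returned.
  suffices hsuff : ∃ (E' : A.Execution) (m : ℕ), E'.Starts n c T ∧ E'.Ends n c m ρ ∧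
      ∀ t i p q d, n ≤ t → t ≤ m → ¬ E'.Receives t i p q d by
    obtain ⟨E', m, h1, h2, h3⟩ := hsuff
    obtain ⟨x⟩ := ‹Nonempty Obj›
    obtain ⟨⟨s, -, hs⟩, -⟩ := H.reveal_eq E' n c T m ρ h1 h2 x (H.reads x)
    have : E'.inbox c s n m = [] := by
      by_contra hne
      obtain ⟨t, i, d, h4, h5, h6⟩ := exists_receives_of_inbox_ne_nil hne
      exact h3 _ _ _ _ _ h4 h5 h6
    rw [this, H.reveal_nil] at hs
    cases hs
  cases k with
  | zero =>
    obtain ⟨E', hE', hag, hs⟩ := exists_extend s₀ H.injective hE n (.start c T) hf.active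
      fun c' T' h => by cases h; exact H.readOnly
    refine ⟨E', n, hs, ⟨⟨le_rfl, fun k h1 h2 => by omega⟩, .start T, by rw [hs]; rfl, ?_⟩, ?_⟩
    · rw [(hag.fresh hf).clientState H.respond]; exact hρ
    · intro t i p q d h1 h2 hr
      obtain rfl : t = n := by omega
      have := hs.symm.trans hr.1
      cases this
  | succ k =>
    obtain ⟨E₁, hE₁, hag₁, hs₁, hst, hsv, hrun, hrec, -⟩ :=
      exists_solo H s₀ hE hf k fun j hj => ih j (by omega)
    obtain ⟨E', hE', hag, ha⟩ := exists_extend s₀ H.injective hE₁ (n + k + 1) (.clientTick c)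
      (hrun.2 _ (by omega) le_rfl) fun c' T' h => by cases h
    have hcfg := hag.cfg le_rfl
    refine ⟨E', n + k + 1, (hag n (by omega)).trans hs₁,
      ⟨⟨by omega, fun k' h1 h2 => ?_⟩, .tick, by rw [ha]; rfl, ?_⟩, ?_⟩
    · rw [hag.cfg h2]
      exact hrun.2 _ h1 h2
    · rw [hcfg, hst]; exact hρ
    · intro t i p q d h1 h2 hr
      rcases Nat.lt_or_ge t (n + k + 1) with h | h
      · exact hrec _ _ _ _ _ h1 h ((hag.receives h).1 hr)
      · obtain rfl : t = n + k + 1 := by omega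
        have := ha.symm.trans hr.1
        cases this

end FastStorage

/-! ### Letting one server answer while the others stand still -/

namespace Execution

/-- `E'` continues the first `N` steps of `E` up to step `N'` by steps of server `q`, which receives
only messages from client `c`. -/
structure ServerExtends (Tw : Txn Obj Val) (c : Client) (q : Server) (E : A.Execution) (N : ℕ)
    (E' : A.Execution) (N' : ℕ) : Prop where
  single : SingleWrite Tw E'
  agree : AgreeTo N E E'
  le : N ≤ N'
  receives : ∀ t i p d m, N ≤ t → t < N' → E'.Receives t i p d m → p = Sum.inl c
  state : ∀ s, s ≠ q → (E'.cfg N').serverState s = (E.cfg N).serverState s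
  -- Messages to `q` are left out because `q` may receive them.
  pending : ∀ i p d m, d ≠ Sum.inr q → Pending (E.cfg N) i p d m → Pending (E'.cfg N') i p d m

theorem ServerExtends.trans {Tw : Txn Obj Val} {c : Client} {q : Server} {E E' E'' : A.Execution}
    {N N' N'' : ℕ} (h : ServerExtends Tw c q E N E' N') (h' : ServerExtends Tw c q E' N' E'' N'') :
    ServerExtends Tw c q E N E'' N'' where
  single := h'.single
  agree := h.agree.trans h'.agree h.le
  le := h.le.trans h'.le
  receives t i p d m h1 h2 hr := by
    rcases Nat.lt_or_ge t N' with h3 | h3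
    · exact h.receives t i p d m h1 h3 ((h'.agree.receives h3).1 hr)
    · exact h'.receives t i p d m h3 h2 hr
  state s hs := (h'.state s hs).trans (h.state s hs)
  pending i p d m hd hp := h'.pending i p d m hd (h.pending i p d m hd hp)

/-- A step of server `q`. -/
theorem exists_serverExtends_step (s₀ : Server) {Tw : Txn Obj Val}
    (hTw : ∀ x x' v, Tw.writes x = some v → Tw.writes x' = some v → x = x')
    {E : A.Execution} (hE : SingleWrite Tw E) (N : ℕ) (c : Client) (q : Server)
    {a : Action Obj Val Client Server} (ha : Enabled (E.cfg N) a)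
    {inp : Option ((Client ⊕ Server) × Msg)} (hinp : serverInput (E.cfg N) a = some (q, inp))
    (hc : ∀ p m, inp = some (p, m) → p = Sum.inl c) :
    ∃ E' : A.Execution, ServerExtends Tw c q E N E' (N + 1) ∧ E'.act N = a ∧
      (E'.cfg (N + 1)).serverState q = (A.serverStep q ((E.cfg N).serverState q) inp).1 ∧
      ∀ d m, (d, m) ∈ (A.serverStep q ((E.cfg N).serverState q) inp).2 →
        ∃ i, Pending (E'.cfg (N + 1)) i (Sum.inr q) d m := by
  obtain ⟨E', hE', hag, hact⟩ := exists_extend s₀ hTw hE N a ha (by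
    rintro c T rfl
    cases hinp)
  have hcfg := hag.cfg le_rfl
  have hnext := next_serverState (A := A) _ hinp
  rw [← hcfg, ← hact, ← E'.cfg_succ, hcfg] at hnext
  refine ⟨E', ⟨hE', hag, by omega, ?_, ?_, ?_⟩, hact, hnext.1, ?_⟩
  · intro t i p d m h1 h2 hr
    obtain rfl : t = N := by omega
    have hi : Protocol.serverInput (E.cfg t) a = some (q, inp) := hinp
    rw [← hcfg, ← hact] at hi
    obtain ⟨h3, h4⟩ := hr
    rcases d with d | d
    · simp [Protocol.serverInput, h3, h4] at hi
    · simp [Protocol.serverInput, h3, h4] at hi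
      exact hc p m hi.2.symm
  · intro s hs
    rw [E'.cfg_succ, next_serverState_of_none, hcfg]
    rw [hact, hcfg]
    intro inp' h
    rw [hinp] at h
    cases h
    exact hs rfl
  · intro i p d m hd hp
    rw [E'.cfg_succ]
    refine pending_next _ (hcfg ▸ hp) ?_
    rw [hact]
    rintro rfl
    rcases d with d | d
    · simp [Protocol.serverInput, hp.1] at hinp
    · simp [Protocol.serverInput, hp.1] at hinp
      exact hd (by rw [hinp.1])
  · intro d m hm
    have hsent := hnext.2
    rw [← hcfg] at hsent hm
    obtain ⟨i, hi⟩ := exists_sends_of_mem hsent (List.mem_map_of_mem hm)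
    exact ⟨i, hi.pending⟩

/-- Local steps of server `q`. -/
theorem exists_serverExtends_ticks (s₀ : Server) {Tw : Txn Obj Val}
    (hTw : ∀ x x' v, Tw.writes x = some v → Tw.writes x' = some v → x = x')
    {E : A.Execution} (hE : SingleWrite Tw E) (N : ℕ) (c : Client) (q : Server) (a : ℕ) :
    ∃ (E' : A.Execution) (N' : ℕ), ServerExtends Tw c q E N E' N' ∧
      (E'.cfg N').serverState q = serverSolo A q ((E.cfg N).serverState q) a ∧
      ∀ i p d m, Pending (E.cfg N) i p d m → Pending (E'.cfg N') i p d m := by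
  induction a with
  | zero =>
    exact ⟨E, N, ⟨hE, fun _ _ => rfl, le_rfl, fun t _ _ _ _ h1 h2 => by omega, fun _ _ => rfl,
      fun _ _ _ _ _ h => h⟩, rfl, fun _ _ _ _ h => h⟩
  | succ a ih =>
    obtain ⟨E₁, N₁, h1, h2, h3⟩ := ih
    obtain ⟨E', h4, h5, h6, -⟩ := exists_serverExtends_step s₀ hTw h1.single N₁ c q
      (a := .serverTick q) trivial (inp := none) rfl (by simp)
    refine ⟨E', N₁ + 1, h1.trans h4, by rw [h6, h2, serverSolo_succ], fun i p d m hp => ?_⟩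
    rw [E'.cfg_succ, h4.agree.cfg le_rfl]
    exact pending_next _ (h3 i p d m hp) (by rw [h5]; simp)

/-- A server can be made to answer the pending message of a client. -/
theorem exists_serverExtends_answer (s₀ : Server) {Tw : Txn Obj Val}
    (hTw : ∀ x x' v, Tw.writes x = some v → Tw.writes x' = some v → x = x')
    {E : A.Execution} (hE : SingleWrite Tw E) {N i : ℕ} {c : Client} {q : Server} {b m : Msg}
    (hp : Pending (E.cfg N) i (Sum.inl c) (Sum.inr q) b) {a j : ℕ}
    (hm : (Sum.inl c, m) ∈ serverAnswer A q (serverSolo A q ((E.cfg N).serverState q) a) c b j) :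
    ∃ (E' : A.Execution) (N' : ℕ), ServerExtends Tw c q E N E' N' ∧
      ∃ r, Pending (E'.cfg N') r (Sum.inr q) (Sum.inl c) m := by
  obtain ⟨E₁, N₁, h1, h2, h3⟩ := exists_serverExtends_ticks s₀ hTw hE N c q a
  have hp₁ := h3 _ _ _ _ hp
  obtain ⟨E₂, h4, -, h5, h6⟩ := exists_serverExtends_step s₀ hTw h1.single N₁ c q
    (a := .deliver i) hp₁.enabled (inp := some (Sum.inl c, b))
    (by simp [Protocol.serverInput, hp₁.1]) (by
      intro p m h
      cases h; rfl)
  rw [h2] at h5 h6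
  cases j with
  | zero => exact ⟨E₂, _, h1.trans h4, h6 _ _ hm⟩
  | succ j =>
    obtain ⟨E₃, N₃, h7, h8, -⟩ := exists_serverExtends_ticks s₀ hTw h4.single (N₁ + 1) c q j
    obtain ⟨E', h9, -, -, h10⟩ := exists_serverExtends_step s₀ hTw h7.single N₃ c q
      (a := .serverTick q) trivial (inp := none) rfl (by simp)
    rw [h8, h5] at h10
    exact ⟨E', _, ((h1.trans h4).trans h7).trans h9, h10 _ _ hm⟩

end Execution

/-! ### Mixed reads, and the invisibility of written values -/

namespace FastStorage

open Execution

variable {stores : Server → Set Obj}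
  {reveal : Client → CState → Txn Obj Val → Server → List Msg → Obj → Option (Option Val)}
  {T Tw : Txn Obj Val}

/-- The answers of two servers to a fresh client can be received in one invocation. -/
theorem exists_mixed_read [Finite Server] [Nonempty Obj] (H : FastStorage A stores reveal T Tw)
    {E : A.Execution} (hE : SingleWrite Tw E) {n : ℕ} {c : Client} (hf : E.Fresh n c)
    {q₁ q₂ : Server} (hq : q₁ ≠ q₂) {m₁ m₂ : Msg}
    (hm₁ : Reply A c T q₁ ((E.cfg n).serverState q₁) m₁)
    (hm₂ : Reply A c T q₂ ((E.cfg n).serverState q₂) m₂) :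
    ∃ (E' : A.Execution) (m : ℕ) (ρ : Obj → Option Val), SingleWrite Tw E' ∧ E'.Starts n c T ∧
      E'.Ends n c m ρ ∧
      (∀ x ∈ stores q₁, ∀ v, reveal c (A.clientInit c) T q₁ [m₁] x = some v → v = ρ x) ∧
      (∀ x ∈ stores q₂, ∀ v, reveal c (A.clientInit c) T q₂ [m₂] x = some v → v = ρ x) := by
  obtain ⟨k₁, b₁, a₁, j₁, hb₁, hm₁⟩ := hm₁
  obtain ⟨k₂, b₂, a₂, j₂, hb₂, hm₂⟩ := hm₂
  -- After `max k₁ k₂` local steps both requests `b₁` and `b₂` are in transit, and the servers are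
  -- still in their states at step `n`.
  obtain ⟨E₁, hE₁, hag₁, hs₁, -, hsv, -, hrec₁, hpend⟩ := exists_solo H q₁ hE hf (max k₁ k₂)
    fun j _ => clientSolo_not_return H q₁ hE hf j
  set N := n + max k₁ k₂ + 1 with hN
  obtain ⟨i₁, hi₁⟩ := hpend _ _ _ (le_max_left k₁ k₂) hb₁
  obtain ⟨i₂, hi₂⟩ := hpend _ _ _ (le_max_right k₁ k₂) hb₂
  rw [← hsv] at hm₁ hm₂
  obtain ⟨E₂, N₂, h2, r₁, hr₁⟩ := exists_serverExtends_answer q₁ H.injective hE₁ hi₁ hm₁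
  -- While `q₁` answers, `q₂` neither moves nor loses its pending request, so the answer `m₂`
  -- remains possible.
  rw [← h2.state q₂ hq.symm] at hm₂
  obtain ⟨E₃, N₃, h3, r₂, hr₂⟩ := exists_serverExtends_answer q₁ H.injective h2.single
    (h2.pending _ _ _ _ (by simpa using hq.symm) hi₂) hm₂
  have hr₁' := h3.pending _ _ _ _ (by simp) hr₁
  have hne : r₂ ≠ r₁ := by
    rintro rfl
    have := hr₁'.1.symm.trans hr₂.1
    simp [hq] at this
  obtain ⟨E₄, hE₄, hag₄, ha₄⟩ := exists_extend q₁ H.injective h3.single N₃ (.deliver r₁)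
    hr₁'.enabled fun c' T' h => by cases h
  have hc₄ := hag₄.cfg le_rfl
  have hr₂' : Pending (E₄.cfg (N₃ + 1)) r₂ (Sum.inr q₂) (Sum.inl c) m₂ := by
    rw [E₄.cfg_succ, hc₄]
    exact pending_next _ hr₂ (by rw [ha₄]; simpa using hne.symm)
  obtain ⟨E₅, hE₅, hag₅, ha₅⟩ := exists_extend q₁ H.injective hE₄ (N₃ + 1) (.deliver r₂)
    hr₂'.enabled fun c' T' h => by cases h
  -- After the two deliveries the execution goes on serving `c` only, so that fastness of `T`
  -- applies to it.
  obtain ⟨e, he⟩ := exists_recurrent (ℕ ⊕ Server ⊕ Unit)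
  obtain ⟨E', hE', hag', hloc⟩ := exists_branch q₁ H.injective hE₅ (N₃ + 2)
    (fun t g => localAction q₁ c (e t) g)
    fun t g c' T' h => absurd h (localAction_ne_start _ _ _ _ _ _)
  have hN₂ := h2.le
  have hN₃ := h3.le
  have ag4 : AgreeTo (N₃ + 1) E₄ E' := hag₅.trans hag' (by omega)
  have ag3 : AgreeTo N₃ E₃ E' := hag₄.trans ag4 (by omega)
  have ag2 : AgreeTo N₂ E₂ E' := h3.agree.trans ag3 hN₃
  have ag1 : AgreeTo N E₁ E' := h2.agree.trans ag2 hN₂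
  have hf' := (hag₁.trans ag1 (by omega)).fresh hf
  have hs : E'.Starts n c T := (ag1 n (by omega)).trans hs₁
  have hR₁ : E'.Receives N₃ r₁ (Sum.inr q₁) (Sum.inl c) m₁ :=
    ⟨(ag4 _ (by omega)).trans ha₄, by rw [ag3.cfg le_rfl]; exact hr₁'.1⟩
  have hR₂ : E'.Receives (N₃ + 1) r₂ (Sum.inr q₂) (Sum.inl c) m₂ :=
    ⟨(hag' _ (by omega)).trans ha₅, by rw [ag4.cfg le_rfl]; exact hr₂'.1⟩
  -- before the two answers, only servers receive messages, from `c`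
  have hbefore : ∀ t i p d b, n ≤ t → t < N₃ → E'.Receives t i p d b → p = Sum.inl c := by
    intro t i p d b h4 h5 h6
    rcases Nat.lt_or_ge t N with h7 | h7
    · exact absurd ((ag1.receives h7).1 h6) (hrec₁ _ _ _ _ _ h4 h7)
    rcases Nat.lt_or_ge t N₂ with h8 | h8
    · exact h2.receives _ _ _ _ _ h7 h8 ((ag2.receives h8).1 h6)
    · exact h3.receives _ _ _ _ _ h8 h5 ((ag3.receives h5).1 h6)
  have hserver : ∀ t i p s b, n ≤ t → E'.Receives t i p (Sum.inr s) b → p = Sum.inl c := by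
    intro t i p s b h4 h5
    rcases Nat.lt_or_ge t N₃ with h6 | h6
    · exact hbefore _ _ _ _ _ h4 h6 h5
    rcases Nat.lt_or_ge t (N₃ + 2) with h7 | h7
    · have : t = N₃ ∨ t = N₃ + 1 := by omega
      rcases this with rfl | rfl
      · obtain rfl : r₁ = i := by simpa using hR₁.1.symm.trans h5.1
        have := hR₁.2.symm.trans h5.2
        simp at this
      · obtain rfl : r₂ = i := by simpa using hR₂.1.symm.trans h5.1
        have := hR₂.2.symm.trans h5.2
        simp at this
    · refine receives_of_local ?_ h5
      rw [hloc t h7]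
      exact localTo_localAction _ _ _ _
  obtain ⟨⟨m, ρ, hends⟩, -, hround, -⟩ := H.fast E' n c hs (fairTo_of_local he hloc)
    fun t i s s' d h4 h5 => by
      have := hserver _ _ _ _ _ h4.1 h5
      cases this
  have hreveal := H.reveal_eq E' n c T m ρ hs hends
  rw [hf'.clientState H.respond] at hreveal
  -- a single server cannot reveal all values
  have hlast : N₃ + 1 ≤ m := by
    by_contra hlt
    obtain ⟨x, hx⟩ := H.noFull q₁
    obtain ⟨⟨s, hxs, hsr⟩, -⟩ := hreveal x (H.reads x)
    have hbox : E'.inbox c s n m = [] := by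
      by_contra hne
      obtain ⟨t, i, d, h4, h5, h6⟩ := exists_receives_of_inbox_ne_nil hne
      rcases Nat.lt_or_ge t N₃ with h7 | h7
      · have := hbefore _ _ _ _ _ h4 h7 h6
        cases this
      · obtain rfl : t = N₃ := by omega
        obtain rfl : r₁ = i := by simpa using hR₁.1.symm.trans h6.1
        have := hR₁.2.symm.trans h6.2
        simp only [Option.some.injEq, Envelope.mk.injEq, Sum.inr.injEq] at this
        exact hx (this.1 ▸ hxs)
    rw [hbox, H.reveal_nil] at hsr
    cases hsr
  -- The client receives at most one answer per server, so a delivered answer is the whole inbox.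
  have hbox : ∀ t r q d, n ≤ t → t ≤ m → E'.Receives t r (Sum.inr q) (Sum.inl c) d →
      E'.inbox c q n m = [d] := by
    intro t r q d h4 h5 h6
    refine inbox_eq_singleton h4 h5 h6 fun t' i' d' h7 h8 h9 => ?_
    exact hround q t' t i' r d' d (hends.1.mono h7 h8) (hends.1.mono h4 h5)
      (hf'.length_le_of_receives_by H.respond h7 h9)
      (hf'.length_le_of_receives_by H.respond h4 h6) h9 h6
  have hbox₁ := hbox _ _ _ _ (by omega) (by omega) hR₁
  have hbox₂ := hbox _ _ _ _ (by omega) hlast hR₂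
  refine ⟨E', m, ρ, hE', hs, hends, fun x hx v hv => ?_, fun x hx v hv => ?_⟩
  · exact (hreveal x (H.reads x)).2 q₁ v hx (by rw [hbox₁]; exact hv)
  · exact (hreveal x (H.reads x)).2 q₂ v hx (by rw [hbox₂]; exact hv)

/-- The answers of two servers to a fresh client reveal either initial values only or written
values only. -/
theorem reveal_none_of_ne [Finite Server] [Nonempty Obj] (H : FastStorage A stores reveal T Tw)
    {E : A.Execution} (hE : SingleWrite Tw E) {n : ℕ} {c : Client} (hf : E.Fresh n c)
    {q₁ q₂ : Server} (hq : q₁ ≠ q₂) {m₁ m₂ : Msg}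
    (hm₁ : Reply A c T q₁ ((E.cfg n).serverState q₁) m₁)
    (hm₂ : Reply A c T q₂ ((E.cfg n).serverState q₂) m₂) {x₁ x₂ : Obj}
    (hx₁ : x₁ ∈ stores q₁) (hx₂ : x₂ ∈ stores q₂) {v : Option Val}
    (h₁ : reveal c (A.clientInit c) T q₁ [m₁] x₁ = some none)
    (h₂ : reveal c (A.clientInit c) T q₂ [m₂] x₂ = some v) : v = none := by
  obtain ⟨E', m, ρ, hE', hs, hends, h3, h4⟩ := exists_mixed_read H hE hf hq hm₁ hm₂
  have h5 := h3 _ hx₁ _ h₁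
  rw [h4 _ hx₂ _ h₂]
  by_contra hne
  obtain ⟨u, hu⟩ := Option.ne_none_iff_exists'.1 hne
  exact (exists_write H hE' hs hends hu).2 _ h5.symm

/-- All answers which the servers may give to a fresh client at step `n` reveal initial values
only. -/
def OnlyInitial (stores : Server → Set Obj)
    (reveal : Client → CState → Txn Obj Val → Server → List Msg → Obj → Option (Option Val))
    (T : Txn Obj Val) (c : Client) (E : A.Execution) (n : ℕ) : Prop :=
  ∀ s m x v, x ∈ stores s → Reply A c T s ((E.cfg n).serverState s) m →
    reveal c (A.clientInit c) T s [m] x = some v → v = none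

/-- Different servers are compared directly. Two answers of the same server `q` are compared through
an answer of another server, which exists because `q` does not store all objects. -/
theorem onlyInitial_of_witness [Finite Server] [Nonempty Obj]
    (H : FastStorage A stores reveal T Tw)
    {E : A.Execution} (hE : SingleWrite Tw E) {n : ℕ} {c : Client} (hf : E.Fresh n c)
    {q : Server} {m : Msg} {x : Obj} (hx : x ∈ stores q)
    (hm : Reply A c T q ((E.cfg n).serverState q) m)
    (hr : reveal c (A.clientInit c) T q [m] x = some none) :
    OnlyInitial stores reveal T c E n := by
  intro s d y v hy hd hv
  by_cases hs : q = s
  · subst hs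
    obtain ⟨z, hz⟩ := H.noFull q
    obtain ⟨E', -, -, -, -, ρ, -, hread⟩ := exists_local_read H q hE hf
    obtain ⟨s', d', hs', hd', hr'⟩ := hread z
    -- The witness forces `d'` to reveal `⊥` for `z`, and `d'` in turn forces `d` to reveal initial
    -- values.
    have hne : q ≠ s' := by rintro rfl; exact hz hs'
    rw [reveal_none_of_ne H hE hf hne hm hd' hx hs' hr hr'] at hr'
    exact reveal_none_of_ne H hE hf hne.symm hd' hd hs' hy hr' hv
  · exact reveal_none_of_ne H hE hf hs hm hd hx hy hr hv

/-- The written values never become visible to a fresh client. -/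
theorem onlyInitial [Finite Server] [Nonempty Obj] (H : FastStorage A stores reveal T Tw)
    (s₀ : Server) {E : A.Execution} (hE : SingleWrite Tw E) {n : ℕ} {c : Client}
    (hf : E.Fresh n c) : OnlyInitial stores reveal T c E n := by
  induction n with
  | zero =>
    obtain ⟨E', hE', hag, hs, m, ρ, hends, hread⟩ := exists_local_read H s₀ hE hf
    obtain ⟨x⟩ := ‹Nonempty Obj›
    obtain ⟨s, d, hxs, hd, hr⟩ := hread x
    -- A written value would require `Tw` to start at step 0, but in `E'` this step starts `T`.
    have hρ : ρ x = none := by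
      by_contra hne
      obtain ⟨u, hu⟩ := Option.ne_none_iff_exists'.1 hne
      obtain ⟨⟨c', hc'⟩, -⟩ := exists_write H hE' hs hends hu
      have := hs.symm.trans hc'
      cases this
      obtain ⟨v, hv⟩ := H.writes x
      rw [H.readOnly x] at hv
      cases hv
    rw [hρ] at hr
    exact onlyInitial_of_witness H hE hf hxs hd hr
  | succ n ih =>
    have hf' := hf.mono (Nat.le_succ n)
    obtain ⟨E', hE', hag, hs, m, ρ, hends, hread⟩ := exists_local_read H s₀ hE hf'
    -- at most one server takes a step
    obtain ⟨p, hp⟩ : ∃ p, ∀ s, s ≠ p →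
        (E.cfg (n + 1)).serverState s = (E.cfg n).serverState s := by
      rcases h : serverInput (E.cfg n) (E.act n) with _ | ⟨p, inp⟩
      · exact ⟨s₀, fun s _ => by rw [E.cfg_succ, next_serverState_of_none]; simp [h]⟩
      · refine ⟨p, fun s hs => ?_⟩
        rw [E.cfg_succ, next_serverState_of_none]
        intro inp' h'
        rw [h] at h'
        cases h'
        exact hs rfl
    -- The answer for `x` comes from a server other than `p`; it reveals `⊥` at step `n` by
    -- induction and is still possible at step `n + 1`.
    obtain ⟨x, hx⟩ := H.noFull p
    obtain ⟨s, d, hxs, hd, hr⟩ := hread x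
    have hne : s ≠ p := by rintro rfl; exact hx hxs
    rw [ih hf' s d x _ hxs hd hr] at hr
    rw [← hp s hne] at hd
    exact onlyInitial_of_witness H hE hf hxs hd hr

end FastStorage

/-! ### A fair execution with infinitely many isolated reads -/

theorem Execution.Fair.fairTo {E : A.Execution} (h : E.Fair) (c : Client) : E.FairTo c :=
  ⟨fun n i _ _ hi => h.1 n i (hi.elim (fun h => (List.getElem?_eq_some_iff.1 h).1)
    fun h => (List.getElem?_eq_some_iff.1 h).1), h.2.1, h.2.2 c⟩

theorem taskAction_ne_start (c : Client) (u : ℕ ⊕ Server ⊕ Unit) (c' : Client)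
    (T : Txn Obj Val) : (taskAction c u : Action Obj Val Client Server) ≠ .start c' T := by
  rcases u with i | s | u <;> simp [taskAction]

open Classical in
/-- A scheduler which starts `Tw` at client `cw`, and then alternates the tasks `e 0, e 1, …` with
isolated executions of `T` by the clients `rd 1, rd 3, …`.  Its state counts the completed items. -/
noncomputable def readingScheduler (s₀ : Server) (cw : Client) (rd : ℕ → Client)
    (T Tw : Txn Obj Val) (e : ℕ → ℕ ⊕ Server ⊕ Unit) (n j : ℕ)
    (g : Config Obj Val Client Server Msg SState CState) : Action Obj Val Client Server × ℕ :=
  if n = 0 then (.start cw Tw, j)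
  -- Starting `rd j` moves the state to `j + 1`, so for even `j > 0` this is the reader started
  -- last. For odd `j`, and for `j = 0` by truncated subtraction, the index is even, and such
  -- clients never start.
  else if g.active (rd (j - 1)) ≠ none then (localAction s₀ (rd (j - 1)) (e n) g, j)
  else if Even j then (taskAction cw (e (j / 2)), j + 1)
  else (.start (rd j) T, j + 1)

/-- The executions which arise from `readingScheduler`, where `σ` is the state of the scheduler. -/
structure ReadingExecution (E : A.Execution) (σ : ℕ → ℕ) (s₀ : Server) (cw : Client)
    (rd : ℕ → Client) (T Tw : Txn Obj Val) (e : ℕ → ℕ ⊕ Server ⊕ Unit) : Prop where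
  single : Execution.SingleWrite Tw E
  zero : σ 0 = 0
  act : ∀ n, E.act n =
    guarded s₀ (E.cfg n) (readingScheduler s₀ cw rd T Tw e n (σ n) (E.cfg n)).1
  state : ∀ n, σ (n + 1) = (readingScheduler s₀ cw rd T Tw e n (σ n) (E.cfg n)).2
  injective : Function.Injective rd
  ne : ∀ j, rd j ≠ cw
  recurrent : ∀ x N, ∃ n, N ≤ n ∧ e n = x

namespace ReadingExecution

open Execution

variable {E : A.Execution} {σ : ℕ → ℕ} {s₀ : Server} {cw : Client} {rd : ℕ → Client}
  {T Tw : Txn Obj Val} {e : ℕ → ℕ ⊕ Server ⊕ Unit}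

/-- At step `t`, no reader is active. -/
def Idle (E : A.Execution) (σ : ℕ → ℕ) (rd : ℕ → Client) (t : ℕ) : Prop :=
  t ≠ 0 ∧ (E.cfg t).active (rd (σ t - 1)) = none

theorem first (R : ReadingExecution E σ s₀ cw rd T Tw e) : E.Starts 0 cw Tw ∧ σ 1 = 0 := by
  have h1 := R.act 0
  have h2 := R.state 0
  simp only [readingScheduler, if_true, R.zero] at h1 h2
  rw [guarded_of_enabled (by rw [E.cfg_zero]; rfl)] at h1
  exact ⟨h1, h2⟩

theorem busy (R : ReadingExecution E σ s₀ cw rd T Tw e) {t : ℕ} (ht : t ≠ 0)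
    (h : (E.cfg t).active (rd (σ t - 1)) ≠ none) :
    E.act t = guarded s₀ (E.cfg t) (localAction s₀ (rd (σ t - 1)) (e t) (E.cfg t)) ∧
      σ (t + 1) = σ t := by
  have h1 := R.act t
  have h2 := R.state t
  simp only [readingScheduler, if_neg ht, if_pos h] at h1 h2
  exact ⟨h1, h2⟩

theorem idle_even (R : ReadingExecution E σ s₀ cw rd T Tw e) {t : ℕ} (ht : Idle E σ rd t)
    (hj : Even (σ t)) :
    E.act t = guarded s₀ (E.cfg t) (taskAction cw (e (σ t / 2))) ∧ σ (t + 1) = σ t + 1 := by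
  have h1 := R.act t
  have h2 := R.state t
  simp only [readingScheduler, if_neg ht.1, ne_eq, ht.2, not_true_eq_false, if_false,
    if_pos hj] at h1 h2
  exact ⟨h1, h2⟩

theorem idle_odd (R : ReadingExecution E σ s₀ cw rd T Tw e) {t : ℕ} (ht : Idle E σ rd t)
    (hj : ¬ Even (σ t)) :
    E.act t = guarded s₀ (E.cfg t) (.start (rd (σ t)) T) ∧ σ (t + 1) = σ t + 1 := by
  have h1 := R.act t
  have h2 := R.state t
  simp only [readingScheduler, if_neg ht.1, ne_eq, ht.2, not_true_eq_false, if_false,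
    if_neg hj] at h1 h2
  exact ⟨h1, h2⟩

theorem idle_succ (R : ReadingExecution E σ s₀ cw rd T Tw e) {t : ℕ} (ht : Idle E σ rd t) :
    σ (t + 1) = σ t + 1 := by
  by_cases hj : Even (σ t)
  · exact (R.idle_even ht hj).2
  · exact (R.idle_odd ht hj).2

theorem state_succ (R : ReadingExecution E σ s₀ cw rd T Tw e) (t : ℕ) :
    σ (t + 1) = σ t ∨ σ (t + 1) = σ t + 1 := by
  by_cases ht : t = 0
  · subst ht; left; rw [R.first.2, R.zero]
  by_cases h : (E.cfg t).active (rd (σ t - 1)) = none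
  · exact Or.inr (R.idle_succ ⟨ht, h⟩)
  · exact Or.inl (R.busy ht h).2

theorem mono (R : ReadingExecution E σ s₀ cw rd T Tw e) : Monotone σ :=
  monotone_nat_of_le_succ fun t => by rcases R.state_succ t with h | h <;> omega

/-- Items with a large number are therefore executed late, which turns recurrence in `e` into
recurrence in time. -/
theorem state_le (R : ReadingExecution E σ s₀ cw rd T Tw e) (t : ℕ) : σ t ≤ t := by
  induction t with
  | zero => rw [R.zero]
  | succ t ih => rcases R.state_succ t with h | h <;> omega

theorem starts (R : ReadingExecution E σ s₀ cw rd T Tw e) {t : ℕ} {c : Client} {T' : Txn Obj Val}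
    (hs : E.Starts t c T') (hc : c ≠ cw) :
    Idle E σ rd t ∧ c = rd (σ t) ∧ T' = T := by
  have hs' : E.act t = .start c T' := hs
  by_cases ht : t = 0
  · subst ht
    have := R.first.1.symm.trans hs
    cases this
    exact absurd rfl hc
  by_cases h : (E.cfg t).active (rd (σ t - 1)) = none
  · by_cases hj : Even (σ t)
    · rw [(R.idle_even ⟨ht, h⟩ hj).1] at hs'
      rcases guarded_cases s₀ (E.cfg t) (taskAction cw (e (σ t / 2))) with h1 | h1
      · exact absurd (h1.symm.trans hs') (taskAction_ne_start _ _ _ _)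
      · have := h1.symm.trans hs'; cases this
    · rw [(R.idle_odd ⟨ht, h⟩ hj).1] at hs'
      rcases guarded_cases s₀ (E.cfg t) (.start (rd (σ t)) T) with h1 | h1
      · have := h1.symm.trans hs'; cases this; exact ⟨⟨ht, h⟩, rfl, rfl⟩
      · have := h1.symm.trans hs'; cases this
  · rw [(R.busy ht h).1] at hs'
    rcases guarded_cases s₀ (E.cfg t) (localAction s₀ (rd (σ t - 1)) (e t) (E.cfg t)) with h1 | h1
    · exact absurd (h1.symm.trans hs') (localAction_ne_start _ _ _ _ _ _)
    · have := h1.symm.trans hs'; cases this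

/-- A reader is determined by the value of `σ` at its start, and `σ` increases right after each idle
step, so it takes each value at one idle step at most. -/
theorem starts_unique (R : ReadingExecution E σ s₀ cw rd T Tw e) {t t' : ℕ} {c : Client}
    {T₁ T₂ : Txn Obj Val} (hc : c ≠ cw) (hs : E.Starts t c T₁) (hs' : E.Starts t' c T₂) :
    t = t' := by
  obtain ⟨h1, h2, -⟩ := R.starts hs hc
  obtain ⟨h3, h4, -⟩ := R.starts hs' hc
  have h5 : σ t = σ t' := R.injective (h2.symm.trans h4)
  have h6 := R.idle_succ h1
  have h7 := R.idle_succ h3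
  rcases Nat.lt_trichotomy t t' with h | h | h
  · have := R.mono (Nat.succ_le_of_lt h)
    simp only [Nat.succ_eq_add_one] at this
    omega
  · exact h
  · have := R.mono (Nat.succ_le_of_lt h)
    simp only [Nat.succ_eq_add_one] at this
    omega

theorem fresh_of_starts (R : ReadingExecution E σ s₀ cw rd T Tw e) {t : ℕ} {c : Client}
    {T' : Txn Obj Val} (hc : c ≠ cw) (hs : E.Starts t c T') : E.Fresh t c :=
  fun _ _ hk hs' => hk.ne (R.starts_unique hc hs' hs)

/-- Apart from `cw`, at most one client is active, the reader started last: while it runs, the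
scheduler starts nobody else. -/
theorem active (R : ReadingExecution E σ s₀ cw rd T Tw e) {t : ℕ} {c : Client} (hc : c ≠ cw)
    (h : (E.cfg t).active c ≠ none) : t ≠ 0 ∧ c = rd (σ t - 1) := by
  induction t with
  | zero => rw [E.cfg_zero] at h; exact absurd rfl h
  | succ t ih =>
    refine ⟨by omega, ?_⟩
    by_cases hs : ∃ T', E.Starts t c T'
    · obtain ⟨T', hs⟩ := hs
      obtain ⟨h1, h2, -⟩ := R.starts hs hc
      rw [R.idle_succ h1, Nat.add_sub_cancel, h2]
    · have hact : (E.cfg t).active c ≠ none := by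
        intro h0
        rw [E.cfg_succ] at h
        exact h (next_active_of_none _ (fun T' h' => hs ⟨T', h'⟩) h0)
      obtain ⟨h1, h2⟩ := ih hact
      rw [(R.busy h1 (h2 ▸ hact)).2]
      exact h2

theorem receives (R : ReadingExecution E σ s₀ cw rd T Tw e) {n t i : ℕ} {c : Client}
    {T' : Txn Obj Val} (hc : c ≠ cw) (hs : E.Starts n c T') (hr : E.Running n c t)
    {p : Client ⊕ Server} {s : Server} {m : Msg} (hrec : E.Receives t i p (Sum.inr s) m) :
    p = Sum.inl c := by
  rcases hr.1.eq_or_lt with rfl | hlt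
  · have := hs.symm.trans hrec.1
    cases this
  · have hact := hr.2 t hlt le_rfl
    obtain ⟨h1, h2⟩ := R.active hc hact
    refine receives_of_local ?_ hrec
    rw [(R.busy h1 (h2 ▸ hact)).1, ← h2]
    exact localTo_localAction _ _ _ _

theorem inactive_of_ends (R : ReadingExecution E σ s₀ cw rd T Tw e) {n m k : ℕ} {c : Client}
    {T' : Txn Obj Val} (hc : c ≠ cw) (hs : E.Starts n c T') {ρ : Obj → Option Val}
    (h : E.Ends n c m ρ) (hk : m < k) : (E.cfg k).active c = none := by
  induction k, hk using Nat.le_induction with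
  | base =>
    obtain ⟨-, inp, h1, h2⟩ := h
    rw [E.cfg_succ]
    exact next_active_eq_none _ h1 (by simp [h2])
  | succ k hk ih =>
    rw [E.cfg_succ]
    refine next_active_of_none _ (fun T'' h' => ?_) ih
    have := R.starts_unique hc hs h'
    have := h.1.1
    omega

variable {stores : Server → Set Obj}
  {reveal : Client → CState → Txn Obj Val → Server → List Msg → Obj → Option (Option Val)}

/-- While a reader runs, servers receive messages from it only, so `ends_with_replies` applies; the
answers it uses reveal `⊥` by `onlyInitial`. -/
theorem read_initial [Finite Server] [Nonempty Obj] (R : ReadingExecution E σ s₀ cw rd T Tw e)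
    (H : FastStorage A stores reveal T Tw) {n : ℕ} {c : Client} (hc : c ≠ cw)
    (hs : E.Starts n c T) (hfair : E.FairTo c) :
    ∃ m ρ, E.Ends n c m ρ ∧ ∀ x, ρ x = none := by
  have hf := R.fresh_of_starts hc hs
  obtain ⟨m, ρ, h1, h2⟩ := ends_with_replies H.respond H.reveal_nil H.reveal_eq H.fast hf hs hfair
    fun t i p s m hr hrec => R.receives hc hs hr hrec
  refine ⟨m, ρ, h1, fun x => ?_⟩
  obtain ⟨s, d, hxs, hd, hr⟩ := h2 x (H.reads x)
  exact H.onlyInitial s₀ R.single hf s d x _ hxs hd hr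

/-- If the scheduler never became idle again, it would serve one reader for ever; this is fair to
that reader, so its fast read would end. -/
theorem exists_idle [Finite Server] [Nonempty Obj] (R : ReadingExecution E σ s₀ cw rd T Tw e)
    (H : FastStorage A stores reveal T Tw) (t : ℕ) :
    ∃ t', t ≤ t' ∧ Idle E σ rd t' ∧ σ t' = σ t := by
  by_contra! hno
  have hconst : ∀ t', t ≤ t' → σ t' = σ t := by
    intro t' ht'
    induction t', ht' using Nat.le_induction with
    | base => rfl
    | succ t' ht' ih =>
      by_cases h0 : t' = 0
      · subst h0
        obtain rfl : t = 0 := by omega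
        rw [R.first.2, R.zero]
      · have : (E.cfg t').active (rd (σ t' - 1)) ≠ none := fun h => hno t' ht' ⟨h0, h⟩ ih
        rw [(R.busy h0 this).2, ih]
  have hbusy : ∀ t', t ≤ t' → t' ≠ 0 → (E.cfg t').active (rd (σ t - 1)) ≠ none := by
    intro t' h1 h2 h3
    have h4 := hconst t' h1
    exact hno t' h1 ⟨h2, by rw [h4]; exact h3⟩ h4
  set c := rd (σ t - 1) with hcdef
  have hc : c ≠ cw := R.ne _
  -- Being active, the client must have started a transaction.
  have hnf : ¬ E.Fresh (t + 1) c := fun hf => hbusy (t + 1) (by omega) (by omega) hf.active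
  unfold Fresh at hnf
  push Not at hnf
  obtain ⟨n, T', -, hs⟩ := hnf
  obtain rfl : T' = T := (R.starts hs hc).2.2
  have hfair : E.FairTo c := by
    refine fairTo_of_local R.recurrent (N := t + 1) (s₀ := s₀) fun t' ht' => ?_
    have h1 := hbusy t' (by omega) (by omega)
    have h2 := hconst t' (by omega)
    rw [(R.busy (by omega) (by rw [h2]; exact h1)).1, h2]
  obtain ⟨m, ρ, hends, -⟩ := R.read_initial H hc hs hfair
  exact hbusy (max (t + 1) (m + 1)) (by omega) (by omega)
    (R.inactive_of_ends hc hs hends (by omega))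

theorem exists_idle_state [Finite Server] [Nonempty Obj]
    (R : ReadingExecution E σ s₀ cw rd T Tw e)
    (H : FastStorage A stores reveal T Tw) (j : ℕ) : ∃ t, Idle E σ rd t ∧ σ t = j := by
  induction j with
  | zero =>
    obtain ⟨t, -, h1, h2⟩ := R.exists_idle H 0
    exact ⟨t, h1, by rw [h2, R.zero]⟩
  | succ j ih =>
    obtain ⟨t, h1, h2⟩ := ih
    obtain ⟨t', -, h3, h4⟩ := R.exists_idle H (t + 1)
    exact ⟨t', h3, by rw [h4, R.idle_succ h1, h2]⟩

theorem exists_task [Finite Server] [Nonempty Obj] (R : ReadingExecution E σ s₀ cw rd T Tw e)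
    (H : FastStorage A stores reveal T Tw) (x : ℕ ⊕ Server ⊕ Unit) (n : ℕ) :
    ∃ t, n ≤ t ∧ E.act t = guarded s₀ (E.cfg t) (taskAction cw x) := by
  obtain ⟨k, hk, rfl⟩ := R.recurrent x n
  -- The item of number `2 * k` performs the task `e k`, and `t ≥ 2 * k ≥ n`.
  obtain ⟨t, h1, h2⟩ := R.exists_idle_state H (2 * k)
  have h3 := R.state_le t
  refine ⟨t, by omega, ?_⟩
  rw [(R.idle_even h1 (by rw [h2]; exact even_two_mul k)).1, h2, Nat.mul_div_cancel_left _ two_pos]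

/-- The recurring tasks deliver every message and let all servers and `cw` take steps. Readers need
no task of this kind: at idle steps none of them is active. -/
theorem fair [Finite Server] [Nonempty Obj] (R : ReadingExecution E σ s₀ cw rd T Tw e)
    (H : FastStorage A stores reveal T Tw) : E.Fair := by
  refine ⟨fun n i hi => ?_, fun s n => ?_, fun c n => ?_⟩
  · obtain ⟨t, ht, hact⟩ := R.exists_task H (.inl i) n
    by_cases hr : i ∈ (E.cfg t).received
    · obtain ⟨t', -, ht'⟩ := E.exists_deliver_of_received hr
      exact ⟨t', ht'⟩
    · refine ⟨t, hact.trans (guarded_of_enabled ?_)⟩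
      exact ⟨hi.trans_le (E.sent_length_mono ht), hr⟩
  · obtain ⟨t, ht, hact⟩ := R.exists_task H (.inr (.inl s)) n
    exact ⟨t, ht, hact.trans (guarded_of_enabled trivial)⟩
  · by_cases hc : c = cw
    · subst hc
      obtain ⟨t, ht, hact⟩ := R.exists_task H (.inr (.inr ())) n
      refine ⟨t, ht, ?_⟩
      by_cases ha : (E.cfg t).active c = none
      · exact Or.inr ha
      · exact Or.inl (hact.trans (guarded_of_enabled ha))
    · obtain ⟨t, ht, hidle, -⟩ := R.exists_idle H n
      refine ⟨t, ht, Or.inr ?_⟩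
      by_contra ha
      have := (R.active hc ha).2
      rw [this] at ha
      exact ha hidle.2

theorem exists_read [Finite Server] [Nonempty Obj] (R : ReadingExecution E σ s₀ cw rd T Tw e)
    (H : FastStorage A stores reveal T Tw) (N : ℕ) : ∃ n c, N ≤ n ∧ c ≠ cw ∧ E.Starts n c T := by
  obtain ⟨t, h1, h2⟩ := R.exists_idle_state H (2 * N + 1)
  have h3 := R.state_le t
  refine ⟨t, rd (σ t), by omega, R.ne _, ?_⟩
  refine (R.idle_odd h1 (by rw [h2]; simp)).1.trans (guarded_of_enabled ?_)
  -- An active reader would be `rd (σ t - 1)`, which differs from `rd (σ t)` since `σ t` is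
  -- positive.
  by_contra ha
  have h4 := R.injective (R.active (R.ne _) ha).2
  omega

end ReadingExecution

/-- Written values which never become visible contradict progress. -/
theorem FastStorage.not_progress [Finite Server] [Nonempty Obj] [Nonempty Server]
    [Infinite Client] {stores : Server → Set Obj}
    {reveal : Client → CState → Txn Obj Val → Server → List Msg → Obj → Option (Option Val)}
    {T Tw : Txn Obj Val} (H : FastStorage A stores reveal T Tw) : ¬ A.Progress := by
  intro hprogress
  obtain ⟨s₀⟩ := ‹Nonempty Server›
  obtain ⟨e, he⟩ := exists_recurrent (ℕ ⊕ Server ⊕ Unit)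
  let cl := Infinite.natEmbedding Client
  obtain ⟨E, σ, hE, h0, hact⟩ := exists_execution (A := A) s₀ H.injective
    (readingScheduler s₀ (cl 0) (fun j => cl (j + 1)) T Tw e) 0 (by
      intro n j g c T' h
      unfold readingScheduler at h
      split_ifs at h with h1 h2 h3
      · cases h; exact Or.inr ⟨h1, rfl⟩
      · exact absurd h (localAction_ne_start _ _ _ _ _ _)
      · exact absurd h (taskAction_ne_start _ _ _ _)
      · cases h; exact Or.inl H.readOnly)
  have R : ReadingExecution E σ s₀ (cl 0) (fun j => cl (j + 1)) T Tw e :=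
    ⟨hE, h0, fun n => (hact n).1, fun n => (hact n).2,
      fun i j h => by simpa using h, fun j h => by simpa using cl.injective h, he⟩
  have hfair := R.fair H
  obtain ⟨x⟩ := ‹Nonempty Obj›
  obtain ⟨v, hv⟩ := H.writes x
  obtain ⟨τ, hτ⟩ := hprogress E hfair 0 _ Tw x v R.first.1 hv
  obtain ⟨n, c, hn, hc, hs⟩ := R.exists_read H τ
  obtain ⟨m, ρ, hends, hρ⟩ := R.read_initial H hc hs (hfair.fairTo c)
  -- Both alternatives offered by progress make the late read return a written value, whereas it
  -- returns `⊥`.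
  rcases hτ n c T m ρ hn hs (H.reads x) hends with h | ⟨u, -, -, -, h, -⟩ <;>
    · rw [hρ] at h; cases h

end Protocol
end CausalStorage

/-! ### The impossibility theorem -/

theorem theorem1 {Obj Val Client Server Msg SState CState : Type*}
    [Finite Obj] [Nonempty Obj] [Infinite Val] [Infinite Client] [Finite Server]
    (stores : Server → Set Obj)
    (hstored : ∀ x, ∃ s, x ∈ stores s)
    (hpartial : ∀ s, ∃ x, x ∉ stores s)
    (A : CausalStorage.Protocol Obj Val Client Server Msg SState CState)
    (hend : A.TransactionsEnd)
    (hrespond : A.ServersOnlyRespond)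
    (hone : A.OneVersion stores)
    (hcausal : A.CausallyConsistent)
    (hprogress : A.Progress) :
    ¬ A.FastReadOnly := by
  intro hfast
  obtain ⟨reveal, hnil, hreveal⟩ := hone
  have : Nonempty Server := let ⟨x⟩ := ‹Nonempty Obj›; ⟨(hstored x).choose⟩
  -- Distinct values for the finitely many objects, through embeddings of `Obj` in `ℕ` and of `ℕ` in
  -- `Val`.
  let val : Obj → Val := fun x => Infinite.natEmbedding Val (Finite.equivFin Obj x)
  have hval : Function.Injective val := fun x y h => by simpa [val, Fin.val_inj] using h
  have := Fintype.ofFinite Obj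
  let T : CausalStorage.Txn Obj Val := ⟨Finset.univ, fun _ => none⟩
  let Tw : CausalStorage.Txn Obj Val := ⟨∅, fun x => some (val x)⟩
  have H : CausalStorage.Protocol.FastStorage A stores reveal T Tw :=
    { noFull := hpartial
      respond := hrespond
      reveal_nil := hnil
      reveal_eq := hreveal
      causal := hcausal
      fast := hfast T fun _ => rfl
      readOnly := fun _ => rfl
      reads := fun x => Finset.mem_univ x
      writes := fun x => ⟨val x, rfl⟩
      injective := fun x y v hx hy => hval (by simpa [Tw] using hx.trans hy.symm) }
  exact H.not_progress hprogress
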